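/- Let $\lambda=(\lambda_1,\dots,\lambda_d)$ be a composition of a positive integer $n$, i.e. the $\lambda_i$ are positive integers with $\lambda_1+\cdots+\lambda_d=n$. Definitions. Put $f(x)=x_1^2+\cdots+x_d^2$ on $\mathbb R^d$ and let $\widetilde{\mathcal P}=\mathrm{conv}\{(x,f(x)) : x\in\mathbb Z^d,\ 0\le x_i\le\lambda_i \text{ for all } i\}\subset\mathbb R^{d+1}$ be the lifted pile of cubes, and $\pi(x)=x_1+\cdots+x_d$ for $x\in\mathbb R^{d+1}$, so that $\pi(\widetilde{\mathcal P})=[0,n]$. Let $\Pi_d(\lambda)=\{\frac1n\int_0^n\gamma(t)\,dt\}$, where $\gamma$ runs over the continuous sections of $\pi:\widetilde{\mathcal P}\to[0,n]$, be the monotone path polytope. The lower part of a polytope in $\mathbb R^{r}$ is the set of its points from which no downward move in the direction of the last coordinate stays in the polytope; a lower vertex is a vertex lying in the lower part. Let $\mathcal A_d(\lambda)$ be the arrangement in $\mathbb R^d$ of the hyperplanes $x_i-x_j=s$ with $1\le i<j\le d$ and $s\in\{-\lambda_i+1,\dots,\lambda_j-1\}$; its regions are the connected components of the complement of their union. A $\lambda$-permutation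 is a word $w=w_1\cdots w_n$ in which each $i\in\{1,\dots,d\}$ occurs $\lambda_i$ times. It is nesting if there are $i<j<k<l$ with $w_i=w_l$, $w_j=w_k$ and $w_m\ne w_i$ for all $j\le m\le k$; otherwise it is non-nesting. Let $v_k=e_{w_1}+\cdots+e_{w_k}$ for $0\le k\le n$, and let $\gamma^w$ be the polygonal path in $\widetilde{\mathcal P}$ with successive vertices $(v_k,f(v_k))$, $0\le k\le n$. A lifted monotone $\lambda$-path is an edge path of $\widetilde{\mathcal P}$, strictly increasing with respect to $\pi$ and projecting onto $[0,n]$, which lies in the lower part of $\widetilde{\mathcal P}$; the paths $\gamma^w$ are of this kind. A $\pi$-increasing edge path $p$ of $\widetilde{\mathcal P}$ that projects onto $[0,n]$ is $\pi$-coherent if there is a linear functional $c$ on $\mathbb R^{d+1}$ such that $\pi^c=(\pi,c)$ maps $p$ onto the lower part of the polygon $\pi^c(\widetilde{\mathcal P})$ and $c$ is generic, meaning that every point of this lower part has exactly one preimage in $\widetilde{\mathcal P}$. Theorem. 1. For every $\lambda$-permutation $w$, the path $\gamma^w$ is $\pi$-coherent if and only if $w$ is non-nesting. 2. The non-nesting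 $\lambda$-permutations are in bijection with the regions of $\mathcal A_d(\lambda)$: the map sending $w$ to the set of $x\in\mathbb R^d$ for which the sequence $k\mapsto x_{w_k}+\#\{j<k : w_j=w_k\}$ $(1\le k\le n)$ is strictly increasing is such a bijection. 3. The number of $\pi$-coherent lifted monotone $\lambda$-paths, the number of lower vertices of $\Pi_d(\lambda)$ and the number of regions of $\mathcal A_d(\lambda)$ are all equal to $$\frac{n!}{(n-d+1)!}.$$ In particular this number depends only on $n$ and $d$. -/

import Mathlib

noncomputable section

namespace LambdaPile

open MeasureTheory

/-! ### Lower parts, monotone edge paths, coherence, monotone path polytopes -/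

section General

/-- The lower part of a polytope `S` in `F × ℝ` (the last coordinate is the vertical one): the union
of its lower faces, i.e. the points of `S` from which no vertical move downwards stays in `S`. -/
def lowerPart {F : Type*} (S : Set (F × ℝ)) : Set (F × ℝ) :=
  {x | x ∈ S ∧ ∀ t : ℝ, 0 < t → (x.1, x.2 - t) ∉ S}

variable {E : Type*} [NormedAddCommGroup E] [NormedSpace ℝ E]

/-- `p 0, …, p m` are the successive vertices of a maximal monotone edge path of the polytope `P`
with respect to `π`: each `p k` is a vertex of `P`, consecutive ones span an edge (a face which is a
segment) of `P`, `π` strictly increases along the path, and the path projects onto all of `π(P)`. -/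
structure IsMaxMonotoneEdgePath (P : Set E) (π : E → ℝ) {m : ℕ} (p : Fin (m + 1) → E) : Prop where
  vertex : ∀ k, p k ∈ P.extremePoints ℝ
  edge : ∀ k : Fin m, IsExposed ℝ P (segment ℝ (p k.castSucc) (p k.succ))
  increasing : ∀ k : Fin m, π (p k.castSucc) < π (p k.succ)
  start : ∀ x ∈ P, π (p 0) ≤ π x
  finish : ∀ x ∈ P, π x ≤ π (p (Fin.last m))

/-- The set of points traversed by the polygonal path with successive vertices `p 0, …, p m`. -/
def trace {m : ℕ} (p : Fin (m + 1) → E) : Set E :=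
  Set.range p ∪ ⋃ k : Fin m, segment ℝ (p k.castSucc) (p k.succ)

/-- The map `π^c = (π, c)` to the plane. -/
def planeMap (π : E → ℝ) (c : E →ₗ[ℝ] ℝ) (x : E) : ℝ × ℝ := (π x, c x)

/-- `c` is generic: every point on the lower part of the polygon `Q^c = π^c(P)` has a unique
preimage in `P`; equivalently the preimage in `P` of each lower vertex (edge) of `Q^c` is a vertex
(an edge) of `P`, so that the lower path of `Q^c` lifts to a unique edge path of `P`. -/
def IsGeneric (P : Set E) (π : E → ℝ) (c : E →ₗ[ℝ] ℝ) : Prop :=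
  Set.InjOn (planeMap π c) (P ∩ planeMap π c ⁻¹' lowerPart (planeMap π c '' P))

/-- A maximal monotone edge path is `π`-coherent if for some generic linear functional `c` the map
`π^c` sends it to the path of lower edges of the polygon `π^c(P)`. -/
def IsCoherent (P : Set E) (π : E → ℝ) {m : ℕ} (p : Fin (m + 1) → E) : Prop :=
  IsMaxMonotoneEdgePath P π p ∧
    ∃ c : E →ₗ[ℝ] ℝ, IsGeneric P π c ∧
      planeMap π c '' trace p = lowerPart (planeMap π c '' P)

/-- The monotone path polytope: the set of all averages `(1 / vol Q) ∫_Q γ`, where `Q = π(P)` and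
`γ : Q → P` is a (continuous) section of `π : P → Q`. -/
def monotonePathPolytope (P : Set E) (π : E → ℝ) : Set E :=
  {y | ∃ γ : ℝ → E, ContinuousOn γ (π '' P) ∧ (∀ t ∈ π '' P, γ t ∈ P ∧ π (γ t) = t) ∧
    y = (volume.real (π '' P))⁻¹ • ∫ t in π '' P, γ t}

/-- The regions of a hyperplane arrangement: the connected components of the complement of the
union of its hyperplanes. -/
def regions (A : Set (Set E)) : Set (Set E) :=
  {R | ∃ x ∈ (⋃₀ A)ᶜ, R = connectedComponentIn (⋃₀ A)ᶜ x}

end General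

/-! ### The lifted pile of cubes and the arrangement attached to `lam` -/

/-- `f(x) = x₁² + ⋯ + x_d²`. -/
def sqSum {d : ℕ} (x : Fin d → ℝ) : ℝ := ∑ i, x i ^ 2

/-- The lattice points of the box `0 ≤ x_i ≤ lam i`. -/
def pileVertices {d : ℕ} (lam : Fin d → ℕ) : Set (Fin d → ℝ) :=
  {x | (∀ i, 0 ≤ x i ∧ x i ≤ lam i) ∧ ∀ i, ∃ z : ℤ, x i = (z : ℝ)}

/-- The lifted pile of cubes, a polytope in `ℝ^d × ℝ`. -/
def liftedPile {d : ℕ} (lam : Fin d → ℕ) : Set ((Fin d → ℝ) × ℝ) :=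
  convexHull ℝ ((fun x => (x, sqSum x)) '' pileVertices lam)

/-- The projection `π`: the sum of the first `d` coordinates. -/
def coordSum {d : ℕ} (x : (Fin d → ℝ) × ℝ) : ℝ := ∑ i, x.1 i

/-- The polytope `Π_d(lam)`. -/
def pathPolytope {d : ℕ} (lam : Fin d → ℕ) : Set ((Fin d → ℝ) × ℝ) :=
  monotonePathPolytope (liftedPile lam) coordSum

/-- The lower vertices of `Π_d(lam)`. -/
def lowerVertices {d : ℕ} (lam : Fin d → ℕ) : Set ((Fin d → ℝ) × ℝ) :=
  (pathPolytope lam).extremePoints ℝ ∩ lowerPart (pathPolytope lam)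

/-- The arrangement of the hyperplanes `x_i - x_j = s` with `i < j` and
`-lam i + 1 ≤ s ≤ lam j - 1`, in `ℝ^d`. -/
def arrangement {d : ℕ} (lam : Fin d → ℕ) : Set (Set (Fin d → ℝ)) :=
  {H | ∃ i j : Fin d, i < j ∧ ∃ s : ℤ, -(lam i : ℤ) + 1 ≤ s ∧ s ≤ (lam j : ℤ) - 1 ∧
    H = {x : Fin d → ℝ | x i - x j = (s : ℝ)}}

/-- The (intrinsic) lifted monotone `lam`-paths: the maximal monotone edge paths of the lifted pile
of cubes which run in its lower part. The number of edges is not prescribed. -/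
def liftedMonotonePaths {d : ℕ} (lam : Fin d → ℕ) :
    Set (Σ m : ℕ, Fin (m + 1) → (Fin d → ℝ) × ℝ) :=
  {p | IsMaxMonotoneEdgePath (liftedPile lam) coordSum p.2 ∧
    trace p.2 ⊆ lowerPart (liftedPile lam)}

/-! ### Permutations of the multiset `M_lam` -/

/-- The word `w` is a permutation of the multiset containing each `i` with multiplicity `lam i`. -/
def IsLambdaPerm {d n : ℕ} (lam : Fin d → ℕ) (w : Fin n → Fin d) : Prop :=
  ∀ i, (Finset.univ.filter fun k => w k = i).card = lam i

def IsNesting {d n : ℕ} (w : Fin n → Fin d) : Prop :=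
  ∃ i j k l : Fin n, i < j ∧ j < k ∧ k < l ∧ w i = w l ∧ w j = w k ∧
    ∀ m, j ≤ m → m ≤ k → w m ≠ w i

/-- The lattice path `p^w`: it starts at the origin and its `k`-th step is the unit coordinate
vector with index `w k`. -/
def latticePath {d n : ℕ} (w : Fin n → Fin d) (k : Fin (n + 1)) : Fin d → ℝ :=
  ∑ j with j.castSucc < k, Pi.single (w j) 1

/-- The lifted path `γ^w`. -/
def liftedPath {d n : ℕ} (w : Fin n → Fin d) (k : Fin (n + 1)) : (Fin d → ℝ) × ℝ :=
  (latticePath w k, sqSum (latticePath w k))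

/-- The points `x` such that the numbers `x_i, x_i + 1, …, x_i + lam i - 1` (`1 ≤ i ≤ d`), placed
from left to right into the positions of the letter `i` in `w`, form an increasing sequence. -/
def wordRegion {d n : ℕ} (w : Fin n → Fin d) : Set (Fin d → ℝ) :=
  {x | StrictMono fun k : Fin n =>
    x (w k) + ((Finset.univ.filter fun j => j < k ∧ w j = w k).card : ℝ)}

end LambdaPile

end

open LambdaPile

noncomputable section

namespace LambdaPile

/-! ### Prefix counts of words -/

section Words

variable {d n : ℕ}

/-! To a point x of ℝ^d attach the n numbers x_i + m with 0 ≤ m < λ_i. Sorting them and recording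
the letters i gives a word. Two numbers with different letters tie exactly when x_i - x_j is a
difference of two admissible m's, that is, when x lies on a hyperplane of the arrangement; so the
regions are the nonempty sets `wordRegion w`. In a sorted word consecutive occurrences of i are one
unit apart, and two occurrences of j, which are at least one unit apart, do not fit strictly between
them: the word is non-nesting. Conversely `exists_times` gives a non-nesting word its times letter
by letter, and `bijOn_wordRegion` follows.

The same sorting solves linear programs on the pile. On lattice points the functional `cost x` is
separable and convex, and the k-th step of γ^w raises it by 2(x_i + m), where i = w_k has occurred m
times before. Taking the steps in increasing order minimises `cost x` on every slice π = t
(`cost_ge_of_monotone`), uniquely when x lies in `wordRegion w` (`mem_segment_of_cost_le`). This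
makes γ^w coherent. Conversely the slopes of a coherent γ^w strictly increase and have the form a_i
+ b m, which nesting forbids. Integrating over the slices, the average of γ^w is the unique
minimiser of `cost x` on Π_d(λ), hence a lower vertex; separation (`lowerVertices_subset`) shows
that there are no others.

For the count, a non-nesting word is a first-in-first-out queue, determined by the positions where
its letters start. The start functions that arise are the injective ones satisfying a ballot
condition (`ncard_nonnesting`). By the cycle lemma exactly one of the n + 1 translates of an
injection into ℤ/(n+1) is ballot, so (n+1)N = (n+1)n⋯(n-d+2), which is N = n!/(n-d+1)!. -/

/-- The number of occurrences of the letter `i` among the first `k` letters of `w`. -/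
def prefixCount (w : Fin n → Fin d) (i : Fin d) (k : ℕ) : ℕ :=
  (Finset.univ.filter fun j : Fin n => (j : ℕ) < k ∧ w j = i).card

@[simp]
lemma prefixCount_zero (w : Fin n → Fin d) (i : Fin d) : prefixCount w i 0 = 0 := by
  simp [prefixCount]

lemma prefixCount_succ (w : Fin n → Fin d) (i : Fin d) (k : Fin n) :
    prefixCount w i (k + 1) = prefixCount w i k + if w k = i then 1 else 0 := by
  unfold prefixCount
  split_ifs with h
  · rw [← Finset.card_insert_of_notMem (a := k)]
    · congr 1
      ext j
      simp only [Finset.mem_filter, Finset.mem_univ, true_and, Finset.mem_insert]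
      constructor
      · rintro ⟨h1, h2⟩
        rcases Nat.lt_succ_iff_lt_or_eq.1 h1 with h3 | h3
        · exact Or.inr ⟨h3, h2⟩
        · exact Or.inl (Fin.ext h3)
      · rintro (h1 | ⟨h1, h2⟩)
        · subst h1
          exact ⟨Nat.lt_succ_self _, h⟩
        · exact ⟨h1.trans (Nat.lt_succ_self _), h2⟩
    · simp
  · rw [add_zero]
    congr 1
    ext j
    simp only [Finset.mem_filter, Finset.mem_univ, true_and]
    constructor
    · rintro ⟨h1, h2⟩
      refine ⟨lt_of_le_of_ne (Nat.lt_succ_iff.1 h1) ?_, h2⟩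
      intro h3
      exact h (by rw [← Fin.ext h3, h2])
    · rintro ⟨h1, h2⟩
      exact ⟨h1.trans (Nat.lt_succ_self _), h2⟩

lemma prefixCount_succ_self (w : Fin n → Fin d) (k : Fin n) :
    prefixCount w (w k) (k + 1) = prefixCount w (w k) k + 1 := by
  simp [prefixCount_succ]

lemma prefixCount_mono (w : Fin n → Fin d) (i : Fin d) : Monotone (prefixCount w i) := by
  intro a b hab
  apply Finset.card_le_card
  intro j
  simp only [Finset.mem_filter, Finset.mem_univ, true_and]
  exact fun h => ⟨h.1.trans_le hab, h.2⟩

lemma prefixCount_lt (w : Fin n → Fin d) {j : Fin n} {k : ℕ} (h : (j : ℕ) < k) :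
    prefixCount w (w j) j < prefixCount w (w j) k := by
  have := prefixCount_mono w (w j) (Nat.succ_le_of_lt h)
  rw [Nat.succ_eq_add_one, prefixCount_succ_self] at this
  omega

lemma exists_occurrence (w : Fin n → Fin d) (i : Fin d) {k m : ℕ} (h : m < prefixCount w i k) :
    ∃ j : Fin n, (j : ℕ) < k ∧ w j = i ∧ prefixCount w i j = m := by
  induction k with
  | zero => simp at h
  | succ k ih =>
    by_cases hm : m < prefixCount w i k
    · obtain ⟨j, h1, h2⟩ := ih hm
      exact ⟨j, h1.trans (Nat.lt_succ_self _), h2⟩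
    · by_cases hk : k < n
      · have := prefixCount_succ w i ⟨k, hk⟩
        simp only at this
        split_ifs at this with hw
        · exact ⟨⟨k, hk⟩, Nat.lt_succ_self _, hw, by simp only; omega⟩
        · omega
      · exfalso
        apply hm
        refine h.trans_le (Finset.card_le_card ?_)
        intro j
        simp only [Finset.mem_filter, Finset.mem_univ, true_and]
        exact fun h => ⟨by omega, h.2⟩

lemma prefixCount_length {lam : Fin d → ℕ} {w : Fin n → Fin d} (hw : IsLambdaPerm lam w)
    (i : Fin d) : prefixCount w i n = lam i := by
  rw [← hw i]
  simp [prefixCount]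

lemma prefixCount_le {lam : Fin d → ℕ} {w : Fin n → Fin d} (hw : IsLambdaPerm lam w)
    (i : Fin d) {k : ℕ} (hk : k ≤ n) : prefixCount w i k ≤ lam i := by
  rw [← prefixCount_length hw i]
  exact prefixCount_mono w i hk

lemma sum_prefixCount (w : Fin n → Fin d) {k : ℕ} (hk : k ≤ n) :
    ∑ i, prefixCount w i k = k := by
  induction k with
  | zero => simp
  | succ k ih =>
    have := fun i => prefixCount_succ w i ⟨k, hk⟩
    simp only at this
    simp only [this, Finset.sum_add_distrib, ih (by omega)]
    simp

lemma IsLambdaPerm.prefixCount_lt {lam : Fin d → ℕ} {w : Fin n → Fin d} (hw : IsLambdaPerm lam w)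
    (k : Fin n) : prefixCount w (w k) k < lam (w k) := by
  rw [← prefixCount_length hw]
  exact LambdaPile.prefixCount_lt w k.2

lemma IsLambdaPerm.exists_occurrence {lam : Fin d → ℕ} {w : Fin n → Fin d}
    (hw : IsLambdaPerm lam w) {i : Fin d} {m : ℕ} (h : m < lam i) :
    ∃ j : Fin n, w j = i ∧ prefixCount w i j = m := by
  rw [← prefixCount_length hw] at h
  obtain ⟨j, -, h1⟩ := LambdaPile.exists_occurrence w i h
  exact ⟨j, h1⟩

lemma eq_of_prefixCount_eq {w : Fin n → Fin d} {j k : Fin n} (h : w j = w k)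
    (hc : prefixCount w (w j) j = prefixCount w (w k) k) : j = k := by
  rcases lt_trichotomy j k with hjk | hjk | hjk
  · have := LambdaPile.prefixCount_lt w (j := j) (k := k) hjk
    rw [hc, h] at this
    omega
  · exact hjk
  · have := LambdaPile.prefixCount_lt w (j := k) (k := j) hjk
    rw [← hc, ← h] at this
    omega

lemma mem_wordRegion {w : Fin n → Fin d} {x : Fin d → ℝ} :
    x ∈ wordRegion w ↔ StrictMono fun k : Fin n => x (w k) + (prefixCount w (w k) k : ℝ) := Iff.rfl

lemma latticePath_apply (w : Fin n → Fin d) (k : Fin (n + 1)) (i : Fin d) :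
    latticePath w k i = prefixCount w i k := by
  unfold latticePath prefixCount
  rw [Finset.sum_apply, Finset.card_filter, Finset.sum_filter]
  push_cast
  refine Finset.sum_congr rfl fun j _ => ?_
  simp only [Fin.lt_def, Fin.val_castSucc, Pi.single_apply]
  by_cases h : (j : ℕ) < k <;> simp [h, eq_comm]

/-- A nesting produces consecutive occurrences of a letter around two occurrences of another. -/
lemma IsNesting.exists_consecutive {w : Fin n → Fin d} (h : IsNesting w) :
    ∃ i j k l : Fin n, i < j ∧ j < k ∧ k < l ∧ w i = w l ∧ w j = w k ∧
      prefixCount w (w l) l = prefixCount w (w i) i + 1 := by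
  obtain ⟨i, j, k, l, hij, hjk, hkl, hil, hw, hm⟩ := h
  -- The outer letter is absent only from j to k, so i and l need not be consecutive. Its count is
  -- constant there; the last occurrence before j and the first one after k replace i and l.
  have hconst : ∀ q : ℕ, (j : ℕ) ≤ q → q ≤ k + 1 →
      prefixCount w (w i) q = prefixCount w (w i) j := by
    intro q h1
    induction q, h1 using Nat.le_induction with
    | base => intro; rfl
    | succ q hq ih =>
      intro hq2
      have hqn : q < n := by omega
      have h3 := prefixCount_succ w (w i) ⟨q, hqn⟩
      rw [if_neg (hm ⟨q, hqn⟩ hq (by simp only [Fin.le_def]; omega))] at h3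
      simp only at h3
      rw [h3, add_zero, ih (by omega)]
  have h1 : prefixCount w (w i) j - 1 < prefixCount w (w i) j := by
    have := prefixCount_lt w (j := i) (k := j) hij
    omega
  obtain ⟨i', hi'1, hi'2, hi'3⟩ := exists_occurrence w (w i) h1
  have h2 : prefixCount w (w i) j < prefixCount w (w i) n := by
    have h3 := prefixCount_lt w l.2
    rw [← hil] at h3
    have h4 := hconst (k + 1) (by simp only [Fin.lt_def] at hjk; omega) le_rfl
    rw [← h4]
    exact (prefixCount_mono w (w i) (Nat.succ_le_of_lt hkl)).trans_lt h3
  obtain ⟨l', hl'1, hl'2, hl'3⟩ := exists_occurrence w (w i) h2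
  have hjl : (j : ℕ) ≤ l' := by
    by_contra hlt
    push Not at hlt
    have := prefixCount_lt w hlt
    rw [hl'2] at this
    omega
  have hkl' : k < l' := by
    by_contra hlt
    push Not at hlt
    exact hm l' hjl hlt hl'2
  refine ⟨i', j, k, l', hi'1, hjk, hkl', by rw [hi'2, hl'2], hw, ?_⟩
  rw [hi'2, hl'2, hi'3, hl'3]
  omega

/-- Letters of a nesting word cannot be given strictly increasing weights which grow by the same
amount from one occurrence of a letter to the next. -/
lemma IsNesting.not_strictMono {w : Fin n → Fin d} (h : IsNesting w) (a : Fin d → ℝ) (b : ℝ) :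
    ¬ StrictMono fun k : Fin n => a (w k) + b * (prefixCount w (w k) k : ℝ) := by
  intro hs
  obtain ⟨i, j, k, l, hij, hjk, hkl, hil, hw, hc⟩ := h.exists_consecutive
  have h1 := hs hij
  have h2 := hs hjk
  have h3 := hs hkl
  have h4 := LambdaPile.prefixCount_lt w (j := j) (k := k) hjk
  simp only [← hil, ← hw] at h1 h2 h3 hc
  have h5 : ((prefixCount w (w j) j : ℝ)) + 1 ≤ prefixCount w (w j) k := by exact_mod_cast h4
  rw [hc] at h3
  push_cast at h3
  -- No sign of b is assumed: the outer pair, one occurrence apart, forces b > 0. The inner pair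
  -- then spans at least b inside a gap of exactly b.
  have hb : 0 < b := by linarith
  nlinarith

end Words

/-! ### Words and regions -/

section Regions

variable {d n : ℕ}

/-- `f` and `l` are the positions of consecutive occurrences of a letter of `w`. -/
def IsArc (w : Fin n → Fin d) (f l : ℕ) : Prop :=
  ∃ (hf : f < n) (hl : l < n), f < l ∧ w ⟨f, hf⟩ = w ⟨l, hl⟩ ∧
    ∀ m : Fin n, f < (m : ℕ) → (m : ℕ) < l → w m ≠ w ⟨f, hf⟩

lemma IsArc.left_unique {w : Fin n → Fin d} {f f' l : ℕ} (h : IsArc w f l) (h' : IsArc w f' l) :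
    f = f' := by
  obtain ⟨hf, hl, h1, h2, h3⟩ := h
  obtain ⟨hf', hl', h1', h2', h3'⟩ := h'
  rcases lt_trichotomy f f' with hff | hff | hff
  · exact absurd (h2'.trans h2.symm) (h3 ⟨f', hf'⟩ hff h1')
  · exact hff
  · exact absurd (h2.trans h2'.symm) (h3' ⟨f, hf⟩ hff h1)

lemma IsArc.right_unique {w : Fin n → Fin d} {f l l' : ℕ} (h : IsArc w f l) (h' : IsArc w f l') :
    l = l' := by
  obtain ⟨hf, hl, h1, h2, h3⟩ := h
  obtain ⟨hf', hl', h1', h2', h3'⟩ := h'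
  rcases lt_trichotomy l l' with hff | hff | hff
  · exact absurd h2.symm (h3' ⟨l, hl⟩ h1 hff)
  · exact hff
  · exact absurd h2'.symm (h3 ⟨l', hl'⟩ h1' hff)

/-- An arc contains no further copy of its letter, so an arc strictly inside it is literally a
nesting. -/
lemma not_arcs_nested {w : Fin n → Fin d} (hw : ¬ IsNesting w) {f f' l l' : ℕ}
    (h : IsArc w f l) (h' : IsArc w f' l') (hf : f < f') : l ≤ l' := by
  by_contra hl
  push Not at hl
  obtain ⟨hfn, hln, h1, h2, h3⟩ := h
  obtain ⟨hfn', hln', h1', h2', h3'⟩ := h'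
  refine hw ⟨⟨f, hfn⟩, ⟨f', hfn'⟩, ⟨l', hln'⟩, ⟨l, hln⟩, hf, h1', hl, h2, h2', ?_⟩
  intro m hm1 hm2
  exact h3 m (lt_of_lt_of_le hf hm1) (lt_of_le_of_lt hm2 hl)

/-- Real times for the letters of a nonnesting word. -/
lemma exists_times {w : Fin n → Fin d} (hw : ¬ IsNesting w) (t : ℕ) :
    ∃ y : ℕ → ℝ, ∀ k < t, (∀ j < k, y j < y k) ∧ (∀ f, IsArc w f k → y k = y f + 1) ∧
      ∀ f l, f ≤ k → k < l → IsArc w f l → y k < y f + 1 := by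
  induction t with
  | zero => exact ⟨0, by simp⟩
  | succ t ih =>
    obtain ⟨y, hy⟩ := ih
    -- The last condition keeps every open arc feasible: an arc opened at f sets the deadline y f +
    -- 1, and no time assigned before it closes may reach this deadline.
    suffices ∃ z : ℝ, (∀ j < t, y j < z) ∧ (∀ f, IsArc w f t → z = y f + 1) ∧
        ∀ f l, f < t → t < l → IsArc w f l → z < y f + 1 by
      obtain ⟨z, h1, h2, h3⟩ := this
      have hne : ∀ j, j < t → Function.update y t z j = y j := fun j hj =>
        Function.update_of_ne hj.ne _ _
      refine ⟨Function.update y t z, fun k hk => ?_⟩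
      rcases Nat.lt_succ_iff_lt_or_eq.1 hk with hk | rfl
      · obtain ⟨g1, g2, g3⟩ := hy k hk
        rw [hne k hk]
        refine ⟨fun j hj => ?_, fun f hf => ?_, fun f l hf hl ha => ?_⟩
        · rw [hne j (hj.trans hk)]
          exact g1 j hj
        · have : f < k := hf.2.2.1
          rw [hne f (this.trans hk)]
          exact g2 f hf
        · rw [hne f (hf.trans_lt hk)]
          exact g3 f l hf hl ha
      · rw [Function.update_self]
        refine ⟨fun j hj => ?_, fun f hf => ?_, fun f l hf hl ha => ?_⟩
        · rw [hne j hj]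
          exact h1 j hj
        · rw [hne f hf.2.2.1]
          exact h2 f hf
        · rcases hf.lt_or_eq with hf | rfl
          · rw [hne f hf]
            exact h3 f l hf hl ha
          · simp
    -- If an arc closes at t, the time is forced; otherwise any value between the times used and the
    -- finitely many deadlines will do.
    by_cases hex : ∃ f, IsArc w f t
    · obtain ⟨f, hf⟩ := hex
      have hft : f < t := hf.2.2.1
      refine ⟨y f + 1, fun j hj => ?_, fun f' hf' => by rw [hf.left_unique hf'],
        fun f' l hf' hl ha => ?_⟩
      · rcases lt_or_ge j f with h | h
        · linarith [(hy f hft).1 j h]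
        · exact (hy j hj).2.2 f t h hj hf
      · have : f < f' := by
          by_contra hlt
          push Not at hlt
          rcases hlt.lt_or_eq with hlt | rfl
          · have := not_arcs_nested hw ha hf hlt
            omega
          · have := ha.right_unique hf
            omega
        linarith [(hy f' hf').1 f this]
    · classical
      have key := Order.exists_between_finsets
        (lo := (Finset.range t).image y)
        (hi := ((Finset.range t).filter fun f => ∃ l, t < l ∧ IsArc w f l).image fun f => y f + 1)
        (by
          intro a ha b hb
          simp only [Finset.mem_image, Finset.mem_range, Finset.mem_filter] at ha hb
          obtain ⟨j, hj, rfl⟩ := ha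
          obtain ⟨f, ⟨hf, l, hl, hfl⟩, rfl⟩ := hb
          rcases lt_or_ge j f with h | h
          · linarith [(hy f hf).1 j h]
          · exact (hy j hj).2.2 f l h (hj.trans hl) hfl)
      obtain ⟨z, hz1, hz2⟩ := key
      refine ⟨z, fun j hj => hz1 _ ?_, fun f hf => (hex ⟨f, hf⟩).elim, fun f l hf hl ha => hz2 _ ?_⟩
      · exact Finset.mem_image_of_mem _ (Finset.mem_range.2 hj)
      · exact Finset.mem_image.2 ⟨f, Finset.mem_filter.2 ⟨Finset.mem_range.2 hf, l, hl, ha⟩, rfl⟩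

/-- A position which is not the first occurrence of its letter ends an arc. -/
lemma exists_isArc {w : Fin n → Fin d} {k : Fin n} (hk : prefixCount w (w k) k ≠ 0) :
    ∃ f : Fin n, IsArc w f k ∧ w f = w k ∧
      prefixCount w (w k) k = prefixCount w (w f) f + 1 := by
  have h1 : prefixCount w (w k) k - 1 < prefixCount w (w k) k := by omega
  obtain ⟨f, hf1, hf2, hf3⟩ := exists_occurrence w (w k) h1
  refine ⟨f, ⟨f.2, k.2, hf1, hf2, fun m hm1 hm2 hm3 => ?_⟩, hf2, by rw [hf2, hf3]; omega⟩
  have h2 := prefixCount_lt w hm2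
  have h3 := prefixCount_lt w hm1
  simp only [Fin.eta] at hm3
  rw [hm3, hf2] at h2
  rw [hf2] at h3
  omega

/-- Take x_i to be the time of the first occurrence of i; each arc adds one, so the m-th later
occurrence has time x_i + m. -/
lemma wordRegion_nonempty {w : Fin n → Fin d} (hw : ¬ IsNesting w) : (wordRegion w).Nonempty := by
  obtain ⟨y, hy⟩ := exists_times hw n
  have hfirst : ∀ k : Fin n, ∃ f : Fin n, w f = w k ∧ prefixCount w (w k) f = 0 := by
    intro k
    have h1 : 0 < prefixCount w (w k) (k + 1) := by rw [prefixCount_succ_self]; omega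
    obtain ⟨f, -, hf⟩ := exists_occurrence w (w k) h1
    exact ⟨f, hf⟩
  classical
  -- The value 0 is for letters absent from w, whose coordinates play no role.
  let x : Fin d → ℝ := fun i =>
    if h : ∃ f : Fin n, w f = i ∧ prefixCount w i f = 0 then y h.choose else 0
  have hx : ∀ m : ℕ, ∀ k : Fin n, prefixCount w (w k) k = m → y k = x (w k) + m := by
    intro m
    induction m with
    | zero =>
      intro k hk
      have hex : ∃ f : Fin n, w f = w k ∧ prefixCount w (w k) f = 0 := hfirst k
      have : hex.choose = k := by
        apply eq_of_prefixCount_eq hex.choose_spec.1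
        rw [hex.choose_spec.1, hex.choose_spec.2, hk]
      simp only [x]
      rw [dif_pos hex, this]
      simp
    | succ m ih =>
      intro k hk
      obtain ⟨f, hf1, hf2, hf3⟩ := exists_isArc (w := w) (k := k) (by omega)
      rw [((hy k k.2).2.1 f hf1), ih f (by omega), hf2]
      push_cast
      ring
  refine ⟨x, ?_⟩
  rw [mem_wordRegion]
  intro j k hjk
  simp only
  rw [← hx _ j rfl, ← hx _ k rfl]
  exact (hy k k.2).1 j hjk

/-- Enumerating the pairs `(i, m)` with `m < lam i` in such a way that `(i, m)` precedes
`(i, m + 1)` gives a word in which `(i, m)` corresponds to the `m`-th occurrence of `i`. -/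
lemma word_of_enumeration {lam : Fin d → ℕ} (e : Fin n ≃ Σ i, Fin (lam i))
    (he : ∀ i (a b : Fin (lam i)), a < b → e.symm ⟨i, a⟩ < e.symm ⟨i, b⟩) :
    IsLambdaPerm lam (fun k => (e k).1) ∧
      ∀ k, prefixCount (fun k => (e k).1) (e k).1 k = (e k).2 := by
  classical
  constructor
  · intro i
    have : (Finset.univ.filter fun k => (e k).1 = i) =
        (Finset.univ : Finset (Fin (lam i))).image fun m => e.symm ⟨i, m⟩ := by
      ext k
      simp only [Finset.mem_filter, Finset.mem_univ, true_and, Finset.mem_image]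
      constructor
      · rintro rfl
        exact ⟨(e k).2, by simp⟩
      · rintro ⟨m, rfl⟩
        simp
    rw [this, Finset.card_image_of_injective]
    · simp
    · intro a b hab
      simpa using hab
  · intro k
    obtain ⟨p, rfl⟩ := e.symm.surjective k
    obtain ⟨i, m⟩ := p
    simp only [Equiv.apply_symm_apply]
    unfold prefixCount
    have : (Finset.univ.filter fun j : Fin n => (j : ℕ) < e.symm ⟨i, m⟩ ∧ (e j).1 = i) =
        (Finset.Iio m).image fun m => e.symm ⟨i, m⟩ := by
      ext k
      simp only [Finset.mem_filter, Finset.mem_univ, true_and, Finset.mem_image, Finset.mem_Iio]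
      constructor
      · rintro ⟨h1, rfl⟩
        refine ⟨(e k).2, ?_, by simp⟩
        by_contra hlt
        push Not at hlt
        rcases hlt.lt_or_eq with hlt | heq
        · have := he _ _ _ hlt
          simp only [Sigma.eta, Equiv.symm_apply_apply] at this
          exact lt_asymm h1 this
        · rw [heq] at h1
          simp at h1
      · rintro ⟨m', hm', rfl⟩
        exact ⟨he _ _ _ hm', by simp⟩
    rw [this, Finset.card_image_of_injective]
    · rw [Equiv.apply_symm_apply]
      simp
    · intro a b hab
      simpa using hab

lemma exists_equiv_strictMono {T α : Type*} [Fintype T] [LinearOrder α] (hT : Fintype.card T = n)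
    (key : T → α) (hkey : Function.Injective key) :
    ∃ e : Fin n ≃ T, StrictMono fun k => key (e k) := by
  let _ : LinearOrder T := LinearOrder.lift' key hkey
  refine ⟨(monoEquivOfFin T hT).toEquiv, fun a b hab => ?_⟩
  have := (monoEquivOfFin T hT).strictMono hab
  exact this

/-- Needed for points on the arrangement. A nesting squeezes a gap of at least one into a gap of
exactly one, so both ends are ties; the tie-break would then order the two letters in both ways. -/
lemma not_isNesting_of_strictMono_lex {w : Fin n → Fin d} {x : Fin d → ℝ}
    (h : StrictMono fun k => toLex (x (w k) + (prefixCount w (w k) k : ℝ), w k)) :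
    ¬ IsNesting w := by
  intro hn
  obtain ⟨i, j, k, l, hij, hjk, hkl, hil, hw, hc⟩ := hn.exists_consecutive
  have g1 := h hij
  have g3 := h hkl
  have g2 := prefixCount_lt w (j := j) (k := k) hjk
  simp only [← hil, ← hw] at g1 g3 hc g2
  rw [hc] at g3
  simp only [Prod.Lex.toLex_lt_toLex] at g1 g3
  have h5 : ((prefixCount w (w j) j : ℝ)) + 1 ≤ prefixCount w (w j) k := by exact_mod_cast g2
  push_cast at g3
  rcases g1 with g1 | ⟨g1, g1'⟩ <;> rcases g3 with g3 | ⟨g3, g3'⟩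
  · linarith
  · linarith
  · linarith
  · exact lt_asymm g1' g3'

/-- Sorting the numbers `x i + m` with ties broken by the letter. -/
lemma exists_sorted_word {lam : Fin d → ℕ} (hsum : ∑ i, lam i = n) (x : Fin d → ℝ) :
    ∃ w : Fin n → Fin d, IsLambdaPerm lam w ∧ ¬ IsNesting w ∧
      StrictMono fun k => toLex (x (w k) + (prefixCount w (w k) k : ℝ), w k) := by
  obtain ⟨e, he⟩ := exists_equiv_strictMono (n := n) (T := Σ i, Fin (lam i))
    (by simp [hsum]) (fun p => toLex (x p.1 + ((p.2 : ℕ) : ℝ), p.1)) (by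
      rintro ⟨i, a⟩ ⟨j, b⟩ h
      simp only [EmbeddingLike.apply_eq_iff_eq, Prod.mk.injEq] at h
      obtain ⟨h1, rfl⟩ := h
      simp only [add_right_inj, Nat.cast_inj] at h1
      rw [Fin.ext h1])
  obtain ⟨h1, h2⟩ := word_of_enumeration e (by
    intro i a b hab
    rw [← he.lt_iff_lt]
    simp only [Equiv.apply_symm_apply, Prod.Lex.toLex_lt_toLex]
    left
    rw [Equiv.apply_symm_apply, Equiv.apply_symm_apply]
    simpa using hab)
  have h3 : StrictMono fun k =>
      toLex (x (e k).1 + (prefixCount (fun k => (e k).1) (e k).1 k : ℝ), (e k).1) := by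
    simp only [h2]
    exact he
  exact ⟨fun k => (e k).1, h1, not_isNesting_of_strictMono_lex h3, h3⟩

/-- The letters of a word sorted as in `exists_sorted_word` have increasing values. -/
lemma monotone_of_strictMono_lex {w : Fin n → Fin d} {x : Fin d → ℝ}
    (h : StrictMono fun k => toLex (x (w k) + (prefixCount w (w k) k : ℝ), w k)) :
    Monotone fun k => x (w k) + (prefixCount w (w k) k : ℝ) := by
  intro j k hjk
  rcases hjk.lt_or_eq with hjk | rfl
  · have := h hjk
    simp only [Prod.Lex.toLex_lt_toLex] at this
    rcases this with h1 | ⟨h1, -⟩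
    · exact h1.le
    · exact h1.le
  · exact le_rfl

/-- Off the arrangement there are no ties. -/
lemma mem_wordRegion_of_notMem {lam : Fin d → ℕ} {w : Fin n → Fin d} (hw : IsLambdaPerm lam w)
    {x : Fin d → ℝ} (hx : x ∉ ⋃₀ arrangement lam)
    (h : StrictMono fun k => toLex (x (w k) + (prefixCount w (w k) k : ℝ), w k)) :
    x ∈ wordRegion w := by
  rw [mem_wordRegion]
  intro j k hjk
  have := h hjk
  simp only [Prod.Lex.toLex_lt_toLex] at this
  rcases this with h1 | ⟨h1, h2⟩
  · exact h1
  · exfalso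
    apply hx
    refine Set.mem_sUnion.2 ⟨_, ⟨w j, w k, h2,
      (prefixCount w (w k) k : ℤ) - prefixCount w (w j) j, ?_, ?_, rfl⟩, ?_⟩
    · have := hw.prefixCount_lt j
      omega
    · have := hw.prefixCount_lt k
      omega
    · simp only [Set.mem_ofPred_eq]
      push_cast
      linarith

/-- Every admissible s is b - a with a < lam i and b < lam j, where one of a, b can be taken to be
0. On the hyperplane x_i + a = x_j + b, so two positions of the sorted word would tie. -/
lemma wordRegion_subset_compl {lam : Fin d → ℕ} (hlam : ∀ i, 0 < lam i)
    {w : Fin n → Fin d} (hw : IsLambdaPerm lam w) :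
    wordRegion w ⊆ (⋃₀ arrangement lam)ᶜ := by
  rintro x hx ⟨H, ⟨i, j, hij, s, hs1, hs2, rfl⟩, hxH⟩
  simp only [Set.mem_ofPred_eq] at hxH
  have key : ∀ a b : ℕ, a < lam i → b < lam j → s = (b : ℤ) - a → False := by
    intro a b ha hb hs
    obtain ⟨p, hp1, hp2⟩ := hw.exists_occurrence ha
    obtain ⟨q, hq1, hq2⟩ := hw.exists_occurrence hb
    have hpq : p = q := by
      apply (mem_wordRegion.1 hx).injective
      simp only [hp1, hq1, hp2, hq2]
      rw [hs] at hxH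
      push_cast at hxH
      linarith
    rw [hpq, hq1] at hp1
    exact hij.ne' hp1
  rcases le_total 0 s with h | h
  · exact key 0 s.toNat (hlam i) (by omega) (by omega)
  · exact key (-s).toNat 0 (by omega) (hlam j) (by omega)

lemma isOpen_wordRegion (w : Fin n → Fin d) : IsOpen (wordRegion w) := by
  have : wordRegion w = ⋂ (j : Fin n) (k : Fin n) (_ : j < k),
      {x | x (w j) + (prefixCount w (w j) j : ℝ) < x (w k) + (prefixCount w (w k) k : ℝ)} := by
    ext x
    simp only [Set.mem_iInter, mem_wordRegion, Set.mem_ofPred_eq]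
    exact ⟨fun h j k hjk => h hjk, fun h j k hjk => h j k hjk⟩
  rw [this]
  refine isOpen_iInter_of_finite fun j => isOpen_iInter_of_finite fun k =>
    isOpen_iInter_of_finite fun _ => isOpen_lt (by fun_prop) (by fun_prop)

lemma convex_wordRegion (w : Fin n → Fin d) : Convex ℝ (wordRegion w) := by
  intro x hx y hy a b ha hb hab
  rw [mem_wordRegion] at *
  intro j k hjk
  have h1 := hx hjk
  have h2 := hy hjk
  simp only [Pi.add_apply, Pi.smul_apply, smul_eq_mul] at *
  have e1 : (prefixCount w (w j) j : ℝ) = (a + b) * (prefixCount w (w j) j : ℝ) := by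
    rw [hab, one_mul]
  have e2 : (prefixCount w (w k) k : ℝ) = (a + b) * (prefixCount w (w k) k : ℝ) := by
    rw [hab, one_mul]
  rw [e1, e2]
  rcases ha.lt_or_eq with ha | rfl
  · nlinarith [mul_lt_mul_of_pos_left h1 ha, mul_le_mul_of_nonneg_left h2.le hb]
  · rw [zero_add] at hab
    subst hab
    linarith

/-- Both words sort the same numbers: matching equal occurrences is a strictly increasing self-map
of `Fin n`, hence the identity. -/
lemma eq_of_mem_wordRegion {lam : Fin d → ℕ} {w w' : Fin n → Fin d} (hw : IsLambdaPerm lam w)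
    (hw' : IsLambdaPerm lam w') {x : Fin d → ℝ} (hx : x ∈ wordRegion w)
    (hx' : x ∈ wordRegion w') : w = w' := by
  have h : ∀ k : Fin n, ∃ j : Fin n, w' j = w k ∧
      prefixCount w' (w k) j = prefixCount w (w k) k := fun k =>
    hw'.exists_occurrence (hw.prefixCount_lt k)
  choose σ hσ1 hσ2 using h
  have hmono : StrictMono σ := by
    intro j k hjk
    rw [← (mem_wordRegion.1 hx').lt_iff_lt]
    simp only [hσ1, hσ2]
    exact mem_wordRegion.1 hx hjk
  have hid : σ = id := by
    have hb : Function.Bijective σ := Finite.injective_iff_bijective.1 hmono.injective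
    let o : Fin n ≃o Fin n := hmono.orderIsoOfSurjective σ hb.2
    have : o = OrderIso.refl _ := Subsingleton.elim _ _
    funext k
    exact congrArg (fun o : Fin n ≃o Fin n => o k) this
  funext k
  rw [← hσ1 k, hid, id]

/-- Sorting shows that the open sets `wordRegion w'` cover the complement; they are disjoint, so a
component cannot leave one of them, and each is convex, hence connected. -/
lemma connectedComponentIn_eq_wordRegion {lam : Fin d → ℕ} (hlam : ∀ i, 0 < lam i)
    (hsum : ∑ i, lam i = n)
    {w : Fin n → Fin d} (hw : IsLambdaPerm lam w) {x : Fin d → ℝ} (hx : x ∈ wordRegion w) :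
    connectedComponentIn (⋃₀ arrangement lam)ᶜ x = wordRegion w := by
  apply Set.Subset.antisymm
  · have hxU := wordRegion_subset_compl hlam hw hx
    have hsub := connectedComponentIn_subset (⋃₀ arrangement lam)ᶜ x
    refine isPreconnected_connectedComponentIn.subset_left_of_subset_union
      (v := ⋃ (w' : Fin n → Fin d) (_ : IsLambdaPerm lam w' ∧ w' ≠ w), wordRegion w')
      (isOpen_wordRegion w)
      (isOpen_iUnion fun w' => isOpen_iUnion fun _ => isOpen_wordRegion w') ?_ ?_
      ⟨x, mem_connectedComponentIn hxU, hx⟩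
    · rw [Set.disjoint_left]
      intro y hy hy'
      simp only [Set.mem_iUnion] at hy'
      obtain ⟨w', ⟨h1, h2⟩, h3⟩ := hy'
      exact h2 (eq_of_mem_wordRegion h1 hw h3 hy)
    · intro y hy
      obtain ⟨w', h1, -, h3⟩ := exists_sorted_word hsum y
      have h4 := mem_wordRegion_of_notMem h1 (hsub hy) h3
      by_cases h : w' = w
      · left
        rwa [← h]
      · right
        simp only [Set.mem_iUnion]
        exact ⟨w', ⟨h1, h⟩, h4⟩
  · exact (convex_wordRegion w).isPreconnected.subset_connectedComponentIn hx
      (wordRegion_subset_compl hlam hw)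

theorem bijOn_wordRegion {lam : Fin d → ℕ} (hlam : ∀ i, 0 < lam i)
    (hsum : ∑ i, lam i = n) :
    Set.BijOn wordRegion {w : Fin n → Fin d | IsLambdaPerm lam w ∧ ¬ IsNesting w}
      (regions (arrangement lam)) := by
  refine ⟨?_, ?_, ?_⟩
  · rintro w ⟨hw, hn⟩
    obtain ⟨x, hx⟩ := wordRegion_nonempty hn
    exact ⟨x, wordRegion_subset_compl hlam hw hx, (connectedComponentIn_eq_wordRegion hlam hsum hw hx).symm⟩
  · rintro w ⟨hw, hn⟩ w' ⟨hw', -⟩ h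
    obtain ⟨x, hx⟩ := wordRegion_nonempty hn
    exact eq_of_mem_wordRegion hw hw' hx (h ▸ hx)
  · rintro R ⟨x, hx, rfl⟩
    obtain ⟨w, h1, h2, h3⟩ := exists_sorted_word hsum x
    exact ⟨w, ⟨h1, h2⟩,
      (connectedComponentIn_eq_wordRegion hlam hsum h1 (mem_wordRegion_of_notMem h1 hx h3)).symm⟩

end Regions

/-! ### A cycle lemma -/

section Cycle

/-- If an integer sequence drops by one over each period of length `n + 1`, then exactly one
residue is a weak minimum of the period which starts there. -/
lemma existsUnique_weak_minimum (n : ℕ) (W : ℕ → ℤ) (hW : ∀ r, W (r + (n + 1)) = W r - 1) :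
    ∃! c, c ≤ n ∧ ∀ u ≤ n, W c ≤ W (c + u) := by
  classical
  have hex : ∃ c, c ≤ n ∧ ∀ r ≤ n, W c ≤ W r := by
    obtain ⟨c, hc, hmin⟩ := Finset.exists_min_image (Finset.range (n + 1)) W ⟨0, by simp⟩
    exact ⟨c, by simpa [Nat.lt_succ_iff] using hc, fun r hr => hmin r (by simp; omega)⟩
  refine existsUnique_of_exists_of_unique ?_ ?_
  -- The leftmost minimum works: earlier values are strictly larger, which absorbs the drop by one
  -- after a full period.
  · refine ⟨Nat.find hex, (Nat.find_spec hex).1, fun u hu => ?_⟩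
    obtain ⟨h1, h2⟩ := Nat.find_spec hex
    by_cases hle : Nat.find hex + u ≤ n
    · exact h2 _ hle
    · obtain ⟨q, hq⟩ : ∃ q, Nat.find hex + u = q + (n + 1) :=
        ⟨Nat.find hex + u - (n + 1), by omega⟩
      have h3 := Nat.find_min hex (m := q) (by omega)
      push Not at h3
      obtain ⟨r, hr1, hr2⟩ := h3 (by omega)
      rw [hq, hW]
      have := h2 r hr1
      omega
  -- Going from a to b and from b around to a + (n + 1) gives W a ≤ W b ≤ W a - 1.
  · have key : ∀ a b, a ≤ n → b ≤ n → (∀ u ≤ n, W a ≤ W (a + u)) → (∀ u ≤ n, W b ≤ W (b + u)) →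
        ¬ a < b := by
      intro a b ha hb h1 h2 hab
      have h3 := h1 (b - a) (by omega)
      rw [Nat.add_sub_cancel' hab.le] at h3
      have h4 := h2 (a + (n + 1) - b) (by omega)
      rw [Nat.add_sub_cancel' (by omega), hW] at h4
      omega
    rintro a b ⟨ha, ha'⟩ ⟨hb, hb'⟩
    have h1 := key a b ha hb ha' hb'
    have h2 := key b a hb ha hb' ha'
    omega

variable {d : ℕ}

/-- The letters that start no later than time `t` provide for more than `t` steps. -/
def IsBallot (n : ℕ) (lam : Fin d → ℕ) (s : Fin d → ℕ) : Prop :=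
  ∀ t < n, t < ∑ i with s i ≤ t, lam i

/-- The letters are grouped by start residue, read cyclically from c. This turns a translation of s
into a shift of the window in a single cumulative sum. -/
lemma sum_val_sub_lt (n : ℕ) (lam : Fin d → ℕ) (s : Fin d → ZMod (n + 1)) (c : ZMod (n + 1))
    (u : ℕ) (hu : u ≤ n + 1) :
    ∑ i with (s i - c).val < u, lam i =
      ∑ q ∈ Finset.range u, ∑ i with s i = ((c.val + q : ℕ) : ZMod (n + 1)), lam i := by
  induction u with
  | zero => simp
  | succ u ih =>
    rw [Finset.sum_range_succ, ← ih (by omega), ← Finset.sum_union]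
    · congr 1
      ext i
      simp only [Finset.mem_filter, Finset.mem_univ, true_and, Finset.mem_union]
      rw [Nat.lt_succ_iff_lt_or_eq]
      refine or_congr Iff.rfl ?_
      constructor
      · intro h
        rw [← h]
        push_cast
        simp
      · intro h
        rw [h]
        push_cast
        simp only [ZMod.natCast_val, ZMod.cast_id', id, add_sub_cancel_left]
        exact ZMod.val_cast_of_lt hu
    · rw [Finset.disjoint_filter]
      intro i _ h1 h2
      rw [h2] at h1
      push_cast at h1
      simp only [ZMod.natCast_val, ZMod.cast_id', id, add_sub_cancel_left] at h1
      rw [ZMod.val_cast_of_lt hu] at h1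
      omega

/-- The cycle lemma. With V the cumulative multiplicity by start residue, V gains n over each period
n + 1, so V r - r drops by one. The translate by c is ballot exactly when c is a weak minimum of V r
- r over the period starting there. -/
lemma existsUnique_isBallot_sub {n : ℕ} {lam : Fin d → ℕ} (hsum : ∑ i, lam i = n)
    (s : Fin d → ZMod (n + 1)) : ∃! c : ZMod (n + 1), IsBallot n lam fun i => (s i - c).val := by
  set V : ℕ → ℕ := fun r => ∑ q ∈ Finset.range r, ∑ i with s i = ((q : ℕ) : ZMod (n + 1)), lam i
    with hV
  have hadd : ∀ (c : ZMod (n + 1)) (u : ℕ), u ≤ n + 1 →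
      V (c.val + u) = V c.val + ∑ i with (s i - c).val < u, lam i := by
    intro c u hu
    rw [sum_val_sub_lt n lam s c u hu, hV]
    simp only [Finset.sum_range_add]
  have hper : ∀ r, V (r + (n + 1)) = V r + n := by
    intro r
    simp only [hV]
    rw [Finset.sum_range_add]
    congr 1
    have h1 := sum_val_sub_lt n lam s (r : ZMod (n + 1)) (n + 1) le_rfl
    rw [Finset.filter_true_of_mem (fun i _ => ZMod.val_lt _), hsum] at h1
    refine Eq.trans (Finset.sum_congr rfl fun q _ => ?_) h1.symm
    push_cast
    simp
  have hiff : ∀ c : ZMod (n + 1), (IsBallot n lam fun i => (s i - c).val) ↔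
      ∀ u ≤ n, (V c.val : ℤ) - c.val ≤ V (c.val + u) - ((c.val + u : ℕ) : ℤ) := by
    intro c
    constructor
    · intro h u hu
      rw [hadd c u (by omega)]
      rcases u with _ | u
      · simp
      · have h1 : u < ∑ i with (s i - c).val < u + 1, lam i := by
          simpa only [Nat.lt_add_one_iff] using h u (by omega)
        generalize (∑ i with (s i - c).val < u + 1, lam i) = A at h1
        push_cast
        omega
    · intro h t ht
      have h1 := h (t + 1) (by omega)
      rw [hadd c (t + 1) (by omega)] at h1
      suffices t < ∑ i with (s i - c).val < t + 1, lam i by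
        simpa only [Nat.lt_add_one_iff] using this
      generalize (∑ i with (s i - c).val < t + 1, lam i) = A at h1
      push_cast at h1
      omega
  obtain ⟨c, ⟨hc1, hc2⟩, hc3⟩ := existsUnique_weak_minimum n (fun r => (V r : ℤ) - r) (by
    intro r
    simp only [hper]
    push_cast
    ring)
  refine ⟨(c : ZMod (n + 1)), ?_, ?_⟩
  · simp only [hiff]
    rw [ZMod.val_cast_of_lt (by omega)]
    exact hc2
  · intro c' hc'
    simp only [hiff] at hc'
    rw [← hc3 c'.val ⟨Nat.lt_succ_iff.1 (ZMod.val_lt _), hc'⟩]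
    simp

/-- The number of injective ballot start functions. -/
lemma card_isBallot {n : ℕ} {lam : Fin d → ℕ} (hsum : ∑ i, lam i = n) :
    (n + 1) * Nat.card {s : Fin d ↪ ZMod (n + 1) // IsBallot n lam fun i => (s i).val} =
      (n + 1).descFactorial d := by
  -- Every injection is a translate of exactly one ballot injection, by a unique shift.
  let F : ZMod (n + 1) × {s : Fin d ↪ ZMod (n + 1) // IsBallot n lam fun i => (s i).val} →
      (Fin d ↪ ZMod (n + 1)) := fun p => p.2.1.trans (addRightEmbedding p.1)
  have hF : ∀ p i, F p i = p.2.1 i + p.1 := fun p i => rfl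
  have hgood : ∀ p, IsBallot n lam fun i => (F p i - p.1).val := by
    intro p
    simp only [hF, add_sub_cancel_right]
    exact p.2.2
  have hbij : Function.Bijective F := by
    constructor
    · intro p q hpq
      have h1 := hgood p
      rw [hpq] at h1
      have h2 := (existsUnique_isBallot_sub hsum (F q)).unique h1 (hgood q)
      refine Prod.ext h2 (Subtype.ext ?_)
      ext i
      have := DFunLike.congr_fun hpq i
      rw [hF, hF, h2, add_left_inj] at this
      rw [this]
    · intro s
      obtain ⟨c, hc, -⟩ := existsUnique_isBallot_sub hsum s
      refine ⟨(c, ⟨s.trans (addRightEmbedding (-c)), ?_⟩), ?_⟩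
      · simpa [sub_eq_add_neg] using hc
      · ext i
        simp [hF]
  have := Nat.card_congr (Equiv.ofBijective F hbij)
  rw [Nat.card_prod, Nat.card_zmod] at this
  rw [this, Nat.card_eq_fintype_card, Fintype.card_embedding_eq, ZMod.card, Fintype.card_fin]

end Cycle

/-! ### Counting nonnesting words -/

section Count

variable {d n : ℕ}

lemma prefixCount_congr {w w' : Fin n → Fin d} {k : ℕ} (h : ∀ j : Fin n, (j : ℕ) < k → w j = w' j)
    {q : ℕ} (hq : q ≤ k) (i : Fin d) : prefixCount w i q = prefixCount w' i q := by
  unfold prefixCount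
  congr 1
  ext j
  simp only [Finset.mem_filter, Finset.mem_univ, true_and]
  refine and_congr_right fun hj => ?_
  rw [h j (hj.trans_le hq)]

/-- Two nonnesting words which agree before `k` continue, if at all, the same letter at `k`. -/
lemma not_lt_of_arcs {lam : Fin d → ℕ} {w w' : Fin n → Fin d} (hw : IsLambdaPerm lam w)
    (hn : ¬ IsNesting w) (hw' : IsLambdaPerm lam w') {k f f' : Fin n}
    (h : ∀ j : Fin n, (j : ℕ) < k → w j = w' j) (hne : w k ≠ w' k) (hf : IsArc w f k)
    (hf' : IsArc w' f' k) (hf'k : w' f' = w' k)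
    (hc : prefixCount w' (w' k) k = prefixCount w' (w' f') f' + 1) : ¬ f' < f := by
  intro hlt
  have hfk : f' < k := hf'.2.2.1
  have h1 := hw'.prefixCount_lt k
  rw [← prefixCount_congr h le_rfl] at h1
  -- The letter `w' k` has the same count before k in w and is not exhausted, so w writes it next at
  -- some j > k. Its arc from f' to j would enclose the arc from f to k.
  obtain ⟨j, hj1, hj2⟩ := hw.exists_occurrence h1
  have hkj : k < j := by
    rcases lt_trichotomy j k with hjk | hjk | hjk
    · have := prefixCount_lt w (j := j) (k := k) hjk
      rw [hj1] at this
      omega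
    · rw [hjk] at hj1
      exact absurd hj1 hne
    · exact hjk
  have hpos : prefixCount w (w j) j ≠ 0 := by
    rw [hj1, hj2, prefixCount_congr h le_rfl, hc]
    omega
  obtain ⟨g, hg1, hg2, hg3⟩ := exists_isArc hpos
  have hgf : g = f' := by
    apply eq_of_prefixCount_eq (w := w)
    · rw [hg2, hj1, h f' hfk, hf'k]
    · rw [hj1, hj2, prefixCount_congr h le_rfl, hc] at hg3
      rw [prefixCount_congr h (show (f' : ℕ) ≤ k from hfk.le), h f' hfk]
      omega
  rw [hgf] at hg1
  have := not_arcs_nested hn hg1 hf hlt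
  exact absurd hkj (not_lt.2 this)

/-- A nonnesting word is determined by the positions of the first occurrences of its letters. -/
lemma eq_of_starts {lam : Fin d → ℕ} {w w' : Fin n → Fin d} (hw : IsLambdaPerm lam w)
    (hn : ¬ IsNesting w) (hw' : IsLambdaPerm lam w') (hn' : ¬ IsNesting w')
    (hs : ∀ k : Fin n, (prefixCount w (w k) k = 0 → w' k = w k) ∧
      (prefixCount w' (w' k) k = 0 → w k = w' k)) : w = w' := by
  have key : ∀ t, ∀ k : Fin n, (k : ℕ) < t → w k = w' k := by
    intro t
    induction t with
    | zero => intro k hk; omega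
    | succ t ih =>
      intro k hk
      have h : ∀ j : Fin n, (j : ℕ) < k → w j = w' j := fun j hj => ih j (by omega)
      by_contra hne
      have hp : prefixCount w (w k) k ≠ 0 := fun h0 => hne ((hs k).1 h0).symm
      have hp' : prefixCount w' (w' k) k ≠ 0 := fun h0 => hne ((hs k).2 h0)
      obtain ⟨f, hf1, hf2, hf3⟩ := exists_isArc hp
      obtain ⟨f', hf1', hf2', hf3'⟩ := exists_isArc hp'
      have h1 := not_lt_of_arcs hw hn hw' h hne hf1 hf1' hf2' hf3'
      have h2 := not_lt_of_arcs hw' hn' hw (fun j hj => (h j hj).symm) (Ne.symm hne) hf1' hf1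
        hf2 hf3
      have h3 : f = f' := le_antisymm (not_lt.1 h1) (not_lt.1 h2)
      apply hne
      rw [← hf2, ← hf2', ← h3, h f hf1.2.2.1]
  funext k
  exact key (k + 1) k (Nat.lt_succ_self _)

/-! ### Start positions and first-in-first-out words -/

lemma exists_start {lam : Fin d → ℕ} (hlam : ∀ i, 0 < lam i) {w : Fin n → Fin d}
    (hw : IsLambdaPerm lam w) (i : Fin d) : ∃ k : Fin n, w k = i ∧ prefixCount w i k = 0 :=
  hw.exists_occurrence (hlam i)

/-- The first t + 1 letters all started by time t, and each letter i is used at most lam i times. -/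
lemma isBallot_of_starts {lam : Fin d → ℕ} {w : Fin n → Fin d}
    (hw : IsLambdaPerm lam w) {s : Fin d → ℕ} (hs : ∀ i, prefixCount w i (s i) = 0) :
    IsBallot n lam s := by
  intro t ht
  rw [← Nat.succ_le_iff]
  conv_lhs => rw [← sum_prefixCount w (Nat.succ_le_of_lt ht)]
  rw [Finset.sum_filter]
  refine Finset.sum_le_sum fun i _ => ?_
  split_ifs with h
  · exact prefixCount_le hw i ht
  · rw [← hs i]
    exact prefixCount_mono w i (by omega)

/-- The word `w` obeys at `k` the first-in-first-out rule with start times `s`. -/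
structure IsQueueStep (lam : Fin d → ℕ) (s : Fin d → ℕ) (w : Fin n → Fin d) (k : Fin n) :
    Prop where
  count_lt : prefixCount w (w k) k < lam (w k)
  eq_of_start : ∀ i, s i = k → w k = i
  start_le : s (w k) ≤ k
  fifo : ∀ i j : Fin n, i < j → j < k → w j = w k → prefixCount w (w i) k < lam (w i) →
    ∃ m : Fin n, j ≤ m ∧ m < k ∧ w m = w i

lemma IsQueueStep.congr {lam : Fin d → ℕ} {s : Fin d → ℕ} {w w' : Fin n → Fin d} {k : Fin n}
    (h : IsQueueStep lam s w k) (hw : ∀ j ≤ k, w j = w' j) : IsQueueStep lam s w' k := by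
  have hp : ∀ i, prefixCount w i k = prefixCount w' i k := fun i =>
    prefixCount_congr (fun j hj => hw j (le_of_lt hj)) le_rfl i
  have hk := hw k le_rfl
  refine ⟨?_, ?_, ?_, ?_⟩
  · rw [← hk, ← hp]
    exact h.count_lt
  · rw [← hk]
    exact h.eq_of_start
  · rw [← hk]
    exact h.start_le
  · intro i j hij hjk h1 h2
    rw [← hw i (hij.trans hjk).le, ← hp] at h2
    rw [← hw j hjk.le, ← hk] at h1
    obtain ⟨m, hm1, hm2, hm3⟩ := h.fifo i j hij hjk h1 h2
    exact ⟨m, hm1, hm2, by rw [← hw m hm2.le, hm3, hw i (hij.trans hjk).le]⟩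

lemma exists_last_occurrence (w : Fin n → Fin d) (i : Fin d) {k : ℕ} (h : prefixCount w i k ≠ 0) :
    ∃ f : Fin n, (f : ℕ) < k ∧ w f = i ∧ ∀ m : Fin n, f < m → (m : ℕ) < k → w m ≠ i := by
  obtain ⟨f, hf1, hf2, hf3⟩ := exists_occurrence w i (show prefixCount w i k - 1 < prefixCount w i k by omega)
  refine ⟨f, hf1, hf2, fun m hm1 hm2 hm3 => ?_⟩
  have h1 := prefixCount_lt w (j := f) (k := m) hm1
  have h2 := prefixCount_lt w hm2
  rw [hf2] at h1
  rw [hm3] at h2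
  omega

/-- The next letter of the first-in-first-out word. -/
lemma exists_next_letter {lam : Fin d → ℕ} (hlam : ∀ i, 0 < lam i) {s : Fin d → ℕ}
    (hs : Function.Injective s) (hb : IsBallot n lam s) {w : Fin n → Fin d} (t : Fin n)
    (hw : ∀ k < t, IsQueueStep lam s w k) :
    ∃ b, prefixCount w b t < lam b ∧ (∀ i, s i = t → b = i) ∧ s b ≤ t ∧
      ∀ i j : Fin n, i < j → j < t → w j = b → prefixCount w (w i) t < lam (w i) →
        ∃ m : Fin n, j ≤ m ∧ m < t ∧ w m = w i := by
  classical
  by_cases hex : ∃ b, s b = t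
  · obtain ⟨b, hbt⟩ := hex
    have hnone : ∀ j < t, w j ≠ b := by
      intro j hj hjb
      have := (hw j hj).start_le
      rw [hjb, hbt] at this
      exact absurd hj (not_lt.2 this)
    refine ⟨b, ?_, fun i hi => hs (hbt.trans hi.symm), hbt.le,
      fun i j _ hj h => absurd h (hnone j hj)⟩
    have : prefixCount w b t = 0 := by
      by_contra h0
      obtain ⟨f, hf1, hf2, -⟩ := exists_last_occurrence w b h0
      exact hnone f hf1 hf2
    rw [this]
    exact hlam b
  -- F collects the latest occurrence of each unfinished letter already in use; its minimum is the
  -- letter that has waited longest.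
  · let F : Finset (Fin n) := Finset.univ.filter fun f => f < t ∧
      prefixCount w (w f) t < lam (w f) ∧ ∀ m : Fin n, f < m → m < t → w m ≠ w f
    have hFmem : ∀ i, prefixCount w i t ≠ 0 → prefixCount w i t < lam i →
        ∃ f ∈ F, w f = i := by
      intro i h0 hi
      obtain ⟨f, hf1, rfl, hf3⟩ := exists_last_occurrence w i h0
      exact ⟨f, by simp only [F, Finset.mem_filter, Finset.mem_univ, true_and]; exact
        ⟨hf1, hi, hf3⟩, rfl⟩
    -- If every started letter were exhausted, the t letters written so far would include all the
    -- supply of the started letters, which exceeds t by the ballot condition.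
    have hopen : ∃ i, s i ≤ t ∧ prefixCount w i t < lam i := by
      by_contra hcon
      push Not at hcon
      have h1 := hb t t.2
      have h2 : ∑ i with s i ≤ t, lam i ≤ ∑ i, prefixCount w i t := by
        rw [Finset.sum_filter]
        refine Finset.sum_le_sum fun i _ => ?_
        split_ifs with h
        · exact hcon i h
        · exact Nat.zero_le _
      rw [sum_prefixCount w t.2.le] at h2
      omega
    have hne : F.Nonempty := by
      obtain ⟨i, hi1, hi2⟩ := hopen
      -- No letter starts at t itself, so an open letter started earlier and has been written.
      have hlt : s i < t := lt_of_le_of_ne hi1 fun h => hex ⟨i, h⟩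
      have hwi := (hw ⟨s i, hlt.trans t.2⟩ hlt).eq_of_start i rfl
      have h0 := prefixCount_lt w (j := ⟨s i, hlt.trans t.2⟩) hlt
      rw [hwi] at h0
      obtain ⟨f, hf, -⟩ := hFmem i (by omega) hi2
      exact ⟨f, hf⟩
    have hf := F.min'_mem hne
    set f := F.min' hne
    simp only [F, Finset.mem_filter, Finset.mem_univ, true_and] at hf
    obtain ⟨hf1, hf2, hf3⟩ := hf
    refine ⟨w f, hf2, fun i hi => (hex ⟨i, hi⟩).elim, (hw f hf1).start_le.trans hf1.le, ?_⟩
    intro i j hij hjt hj hi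
    have h0 := prefixCount_lt w (j := i) (k := t) (hij.trans hjt)
    obtain ⟨f', hf', hf'i⟩ := hFmem (w i) (by omega) hi
    have h1 : f ≤ f' := F.min'_le f' hf'
    have h2 : j ≤ f := by
      by_contra hlt
      push Not at hlt
      exact hf3 j hlt hjt hj
    simp only [F, Finset.mem_filter, Finset.mem_univ, true_and] at hf'
    exact ⟨f', h2.trans h1, hf'.1, hf'i⟩

lemma exists_queue_word {lam : Fin d → ℕ} (hlam : ∀ i, 0 < lam i) {s : Fin d → ℕ}
    (hs : Function.Injective s) (hb : IsBallot n lam s) :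
    ∃ w : Fin n → Fin d, ∀ k, IsQueueStep lam s w k := by
  have key : ∀ t ≤ n, ∃ w : Fin n → Fin d, ∀ k : Fin n, (k : ℕ) < t → IsQueueStep lam s w k := by
    intro t
    induction t with
    | zero =>
      intro
      -- The initial word is arbitrary, but it needs a letter to exist; for positive length the
      -- ballot condition at time 0 supplies one.
      rcases n with _ | n
      · exact ⟨Fin.elim0, by simp⟩
      · have h0 := hb 0 (by omega)
        have : ∃ i : Fin d, True := by
          by_contra h
          push Not at h
          rw [Finset.sum_eq_zero fun i _ => (h i).elim] at h0
          omega
        obtain ⟨i, -⟩ := this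
        exact ⟨fun _ => i, by simp⟩
    | succ t ih =>
      intro ht
      obtain ⟨w, hw⟩ := ih (by omega)
      let T : Fin n := ⟨t, ht⟩
      obtain ⟨b, h1, h2, h3, h4⟩ := exists_next_letter hlam hs hb T fun k hk => hw k hk
      have hne : ∀ j : Fin n, j < T → Function.update w T b j = w j := fun j hj =>
        Function.update_of_ne hj.ne _ _
      have hp : ∀ i, prefixCount (Function.update w T b) i T = prefixCount w i T := fun i =>
        prefixCount_congr (fun j hj => hne j hj) le_rfl i
      refine ⟨Function.update w T b, fun k hk => ?_⟩
      rcases Nat.lt_succ_iff_lt_or_eq.1 hk with hk | hk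
      · exact (hw k hk).congr fun j hj => (hne j (lt_of_le_of_lt hj hk)).symm
      · obtain rfl : k = T := Fin.ext hk
        refine ⟨?_, ?_, ?_, ?_⟩
        · rw [hp, Function.update_self]
          exact h1
        · rw [Function.update_self]
          exact h2
        · rw [Function.update_self]
          exact h3
        · intro i j hij hjk hj hi
          rw [hp, hne i (hij.trans hjk)] at hi
          rw [hne j hjk, Function.update_self] at hj
          obtain ⟨m, hm1, hm2, hm3⟩ := h4 i j hij hjk hj hi
          exact ⟨m, hm1, hm2, by rw [hne m hm2, hne i (hij.trans hjk), hm3]⟩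
  obtain ⟨w, hw⟩ := key n le_rfl
  exact ⟨w, fun k => hw k k.2⟩

/-- A first-in-first-out word is a nonnesting permutation with the prescribed starts. -/
lemma queue_word_spec {lam : Fin d → ℕ} (hlam : ∀ i, 0 < lam i) (hsum : ∑ i, lam i = n)
    {s : Fin d → ℕ} {w : Fin n → Fin d} (h : ∀ k, IsQueueStep lam s w k) :
    IsLambdaPerm lam w ∧ ¬ IsNesting w ∧
      ∀ i, ∃ k : Fin n, s i = k ∧ w k = i ∧ prefixCount w i k = 0 := by
  have hle : ∀ i, prefixCount w i n ≤ lam i := by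
    intro i
    by_contra hlt
    push Not at hlt
    obtain ⟨k, -, rfl, hk⟩ := exists_occurrence w i hlt
    have := (h k).count_lt
    omega
  -- No letter exceeds its multiplicity and the totals agree, so every count is exact.
  have heq := (Finset.sum_eq_sum_iff_of_le (s := Finset.univ) fun i _ => hle i).1
    (by rw [sum_prefixCount w le_rfl, hsum])
  have hw : IsLambdaPerm lam w := by
    intro i
    rw [← heq i (Finset.mem_univ _)]
    simp [prefixCount]
  refine ⟨hw, ?_, ?_⟩
  · rintro ⟨i, j, k, l, hij, hjk, hkl, hil, hjk', hm⟩
    have h1 : prefixCount w (w i) k < lam (w i) := by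
      have h2 := hw.prefixCount_lt l
      rw [← hil] at h2
      exact (prefixCount_mono w (w i) hkl.le).trans_lt h2
    obtain ⟨m, hm1, hm2, hm3⟩ := (h k).fifo i j hij hjk hjk' h1
    exact hm m hm1 hm2.le hm3
  · intro i
    obtain ⟨k, hk1, hk2⟩ := exists_start hlam hw i
    have h1 := (h k).start_le
    rw [hk1] at h1
    have h2 := (h ⟨s i, h1.trans_lt k.2⟩).eq_of_start i rfl
    refine ⟨⟨s i, h1.trans_lt k.2⟩, rfl, h2, ?_⟩
    have := prefixCount_mono w i h1
    simp only
    omega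

/-- The map from words to start functions is injective by `eq_of_starts`, and the queue word of a
ballot injection is a preimage. -/
theorem ncard_nonnesting {lam : Fin d → ℕ} (hlam : ∀ i, 0 < lam i) (hsum : ∑ i, lam i = n) :
    (n + 1) * {w : Fin n → Fin d | IsLambdaPerm lam w ∧ ¬ IsNesting w}.ncard =
      (n + 1).descFactorial d := by
  rw [← card_isBallot hsum, ← Nat.card_coe_set_eq]
  congr 1
  have hst : ∀ w : {w : Fin n → Fin d | IsLambdaPerm lam w ∧ ¬ IsNesting w}, ∀ i,
      ∃ k : Fin n, w.1 k = i ∧ prefixCount w.1 i k = 0 := fun w i => exists_start hlam w.2.1 i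
  choose st hst1 hst2 using hst
  have hval : ∀ k : Fin n, ((k : ℕ) : ZMod (n + 1)).val = k := fun k =>
    ZMod.val_cast_of_lt (k.2.trans (Nat.lt_succ_self n))
  let F : {w : Fin n → Fin d | IsLambdaPerm lam w ∧ ¬ IsNesting w} →
      {s : Fin d ↪ ZMod (n + 1) // IsBallot n lam fun i => (s i).val} := fun w =>
    ⟨⟨fun i => ((st w i : ℕ) : ZMod (n + 1)), fun i j hij => by
      have h1 := congrArg ZMod.val hij
      simp only [hval] at h1
      rw [← hst1 w i, ← hst1 w j, Fin.ext h1]⟩, by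
      apply isBallot_of_starts w.2.1
      intro i
      exact (congrArg (prefixCount w.1 i) (hval (st w i))).trans (hst2 w i)⟩
  have hF : ∀ w i, ((F w).1 i).val = st w i := fun w i => hval _
  refine Nat.card_congr (Equiv.ofBijective F ⟨fun w w' h => ?_, fun s => ?_⟩)
  · have h1 : ∀ i, st w i = st w' i := by
      intro i
      apply Fin.ext
      rw [← hF, ← hF, h]
    have h2 : ∀ (u : {w : Fin n → Fin d | IsLambdaPerm lam w ∧ ¬ IsNesting w}) (k : Fin n),
        prefixCount u.1 (u.1 k) k = 0 → st u (u.1 k) = k := fun u k hk =>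
      eq_of_prefixCount_eq (hst1 u _) (by rw [hst1, hst2, hk])
    refine Subtype.ext (eq_of_starts w.2.1 w.2.2 w'.2.1 w'.2.2 fun k => ⟨fun hk => ?_, fun hk => ?_⟩)
    · have h3 := hst1 w' (w.1 k)
      rwa [← h1, h2 w k hk] at h3
    · have h3 := hst1 w (w'.1 k)
      rwa [h1, h2 w' k hk] at h3
  · obtain ⟨w, hw⟩ := exists_queue_word (n := n) hlam (s := fun i => (s.1 i).val)
      (fun i j hij => s.1.injective (ZMod.val_injective _ hij)) s.2
    obtain ⟨h1, h2, h3⟩ := queue_word_spec hlam hsum hw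
    refine ⟨⟨w, h1, h2⟩, Subtype.ext ?_⟩
    ext i
    apply ZMod.val_injective
    rw [hF]
    obtain ⟨k, hk1, hk2, hk3⟩ := h3 i
    rw [hk1]
    congr 1
    have h4 : w (st ⟨w, h1, h2⟩ i) = i := hst1 ⟨w, h1, h2⟩ i
    have h5 : prefixCount w i (st ⟨w, h1, h2⟩ i) = 0 := hst2 ⟨w, h1, h2⟩ i
    exact eq_of_prefixCount_eq (w := w) (h4.trans hk2.symm) (by rw [h4, h5, hk2, hk3])

theorem ncard_nonnesting_eq {lam : Fin d → ℕ} (hlam : ∀ i, 0 < lam i) (hn : 0 < n)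
    (hsum : ∑ i, lam i = n) :
    (({w : Fin n → Fin d | IsLambdaPerm lam w ∧ ¬ IsNesting w}.ncard : ℕ) : ℚ) =
      (n.factorial : ℚ) / ((n - d + 1).factorial : ℚ) := by
  have h := ncard_nonnesting hlam hsum
  -- All parts are positive, so the truncated subtraction n - d is a true one.
  have hdn : d ≤ n := by
    calc d = ∑ _i : Fin d, 1 := by simp
      _ ≤ ∑ i, lam i := Finset.sum_le_sum fun i _ => hlam i
      _ = n := hsum
  rcases d with _ | d
  · simp at hsum
    omega
  · rw [Nat.succ_descFactorial_succ] at h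
    have h1 := Nat.eq_of_mul_eq_mul_left (Nat.succ_pos n) h
    rw [h1, show n - (d + 1) + 1 = n - d by omega, eq_div_iff (by positivity)]
    rw [mul_comm]
    exact_mod_cast Nat.factorial_mul_descFactorial (by omega : d ≤ n)

end Count

/-! ### Faces of convex hulls -/

section Faces

variable {E : Type*} [AddCommGroup E] [Module ℝ E]

lemma le_of_mem_convexHull {S : Set E} (l : E →ₗ[ℝ] ℝ) {m : ℝ} (h : ∀ s ∈ S, m ≤ l s) {p : E}
    (hp : p ∈ convexHull ℝ S) : m ≤ l p :=
  convexHull_min (s := S) (t := {p | m ≤ l p}) h (convex_halfSpace_ge l.isLinear m) hp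

/-- A point of a convex hull at which a linear functional attains its minimum is in the convex
hull of the generators at which it does. -/
lemma mem_convexHull_face {S : Set E} (l : E →ₗ[ℝ] ℝ) {m : ℝ} (h : ∀ s ∈ S, m ≤ l s) {p : E}
    (hp : p ∈ convexHull ℝ S) (hpm : l p = m) : p ∈ convexHull ℝ {s ∈ S | l s = m} := by
  have hface : ∀ q ∈ convexHull ℝ {s ∈ S | l s = m}, l q = m := fun q hq =>
    convexHull_min (s := {s ∈ S | l s = m}) (t := {p | l p = m}) (fun s hs => hs.2)
      (convex_hyperplane l.isLinear m) hq
  -- The open half-space together with the face is convex and contains S, hence contains the whole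
  -- hull.
  have hconv : Convex ℝ ({p | m < l p} ∪ convexHull ℝ {s ∈ S | l s = m}) := by
    rw [convex_iff_forall_pos]
    intro x hx y hy a b ha hb hab
    by_cases hxm : m < l x
    · left
      have hym : m ≤ l y := by
        rcases hy with hy | hy
        · exact le_of_lt hy
        · exact (hface y hy).ge
      simp only [Set.mem_ofPred_eq, map_add, map_smul, smul_eq_mul]
      have : m = a * m + b * m := by rw [← add_mul, hab, one_mul]
      nlinarith [mul_lt_mul_of_pos_left hxm ha, mul_le_mul_of_nonneg_left hym hb.le]
    · have hx' := hx.resolve_left hxm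
      by_cases hym : m < l y
      · left
        simp only [Set.mem_ofPred_eq, map_add, map_smul, smul_eq_mul, hface x hx']
        have : m = a * m + b * m := by rw [← add_mul, hab, one_mul]
        nlinarith [mul_lt_mul_of_pos_left hym hb]
      · right
        exact convex_convexHull ℝ _ hx' (hy.resolve_left hym) ha.le hb.le hab
  have hsub : S ⊆ {p | m < l p} ∪ convexHull ℝ {s ∈ S | l s = m} := by
    intro s hs
    rcases (h s hs).lt_or_eq with h1 | h1
    · exact Or.inl h1
    · exact Or.inr (subset_convexHull ℝ _ ⟨hs, h1.symm⟩)
  rcases convexHull_min hsub hconv hp with h1 | h1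
  · exact absurd hpm (ne_of_gt h1)
  · exact h1

end Faces

/-! ### Linear functionals on the lifted pile -/

section Pile

variable {d n : ℕ}

/-- The functional `(y, z) ↦ z - ∑ αᵢ yᵢ`. -/
def tilt (α : Fin d → ℝ) : ((Fin d → ℝ) × ℝ) →ₗ[ℝ] ℝ :=
  LinearMap.snd ℝ _ _ - ∑ i, α i • (LinearMap.proj i ∘ₗ LinearMap.fst ℝ (Fin d → ℝ) ℝ)

lemma tilt_apply (α : Fin d → ℝ) (p : (Fin d → ℝ) × ℝ) : tilt α p = p.2 - ∑ i, α i * p.1 i := by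
  simp [tilt]

/-- `coordSum` as a linear functional. -/
def coordSumLinear : ((Fin d → ℝ) × ℝ) →ₗ[ℝ] ℝ :=
  ∑ i, LinearMap.proj i ∘ₗ LinearMap.fst ℝ (Fin d → ℝ) ℝ

lemma coordSumLinear_apply (p : (Fin d → ℝ) × ℝ) : coordSumLinear p = coordSum p := by
  simp [coordSumLinear, coordSum]

lemma tilt_sub_const (α : Fin d → ℝ) (g : ℝ) (p : (Fin d → ℝ) × ℝ) :
    tilt (fun i => g - α i) p = tilt (fun i => -α i) p - g * coordSum p := by
  simp only [tilt_apply, coordSum, Finset.mul_sum, sub_mul, Finset.sum_sub_distrib, neg_mul,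
    Finset.sum_neg_distrib]
  ring

/-- The point of the paraboloid above `v`. -/
def lift (v : Fin d → ℝ) : (Fin d → ℝ) × ℝ := (v, sqSum v)

/-- On the paraboloid a tilt is a sum of one-variable parabolas q² - α_i q, so its minimisers among
lattice points are found coordinate by coordinate. -/
lemma tilt_lift_sub (α y v : Fin d → ℝ) :
    tilt α (lift y) - tilt α (lift v) = ∑ i, (y i - v i) * (y i + v i - α i) := by
  simp only [tilt_apply, lift, sqSum, ← Finset.sum_sub_distrib]
  exact Finset.sum_congr rfl fun i _ => by ring

lemma lift_mem {lam : Fin d → ℕ} {v : Fin d → ℝ} (hv : v ∈ pileVertices lam) :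
    lift v ∈ liftedPile lam :=
  subset_convexHull ℝ _ ⟨v, hv, rfl⟩

lemma natCast_mem_pileVertices {lam v : Fin d → ℕ} (hv : ∀ i, v i ≤ lam i) :
    (fun i => (v i : ℝ)) ∈ pileVertices lam :=
  ⟨fun i => ⟨Nat.cast_nonneg _, Nat.cast_le.2 (hv i)⟩, fun i => ⟨v i, by simp⟩⟩

/-- By convexity q² - aq is minimal at v among the integers of [0, L] once neither neighbour is
lower; at an endpoint the neighbour outside imposes nothing. -/
lemma mul_nonneg_of_int {q v L : ℤ} {a : ℝ} (hq0 : 0 ≤ q) (hqL : q ≤ L)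
    (hu : v < L → a ≤ 2 * v + 1) (hl : 0 < v → 2 * v - 1 ≤ a) :
    0 ≤ ((q : ℝ) - v) * (q + v - a) := by
  rcases lt_trichotomy q v with h | rfl | h
  · have h1 := hl (by omega)
    have h2 : (q : ℝ) + 1 ≤ v := by exact_mod_cast h
    apply mul_nonneg_of_nonpos_of_nonpos <;> linarith
  · simp
  · have h1 := hu (by omega)
    have h2 : (v : ℝ) + 1 ≤ q := by exact_mod_cast h
    apply mul_nonneg <;> linarith

lemma eq_of_mul_eq_zero_of_int {q v L : ℤ} {a : ℝ} (hq0 : 0 ≤ q) (hqL : q ≤ L)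
    (hu : v < L → a < 2 * v + 1) (hl : 0 < v → 2 * v - 1 < a)
    (h0 : ((q : ℝ) - v) * (q + v - a) = 0) : q = v := by
  rcases lt_trichotomy q v with h | rfl | h
  · have h1 := hl (by omega)
    have h2 : (q : ℝ) + 1 ≤ v := by exact_mod_cast h
    nlinarith
  · rfl
  · have h1 := hu (by omega)
    have h2 : (v : ℝ) + 1 ≤ q := by exact_mod_cast h
    nlinarith

lemma tilt_min_on_vertices {lam v : Fin d → ℕ} {α : Fin d → ℝ}
    (hu : ∀ i, v i < lam i → α i ≤ 2 * v i + 1) (hl : ∀ i, 0 < v i → 2 * v i - 1 ≤ α i)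
    {y : Fin d → ℝ} (hy : y ∈ pileVertices lam) :
    (∀ i, 0 ≤ (y i - v i) * (y i + v i - α i)) ∧
      tilt α (lift fun i => (v i : ℝ)) ≤ tilt α (lift y) := by
  have h : ∀ i, 0 ≤ (y i - v i) * (y i + v i - α i) := by
    intro i
    obtain ⟨z, hz⟩ := hy.2 i
    obtain ⟨h1, h2⟩ := hy.1 i
    rw [hz] at h1 h2 ⊢
    have := mul_nonneg_of_int (q := z) (v := v i) (L := lam i) (a := α i) (by exact_mod_cast h1)
      (by exact_mod_cast h2) (fun h => by exact_mod_cast hu i (by exact_mod_cast h))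
      (fun h => by exact_mod_cast hl i (by exact_mod_cast h))
    exact_mod_cast this
  refine ⟨h, ?_⟩
  rw [← sub_nonneg, tilt_lift_sub]
  exact Finset.sum_nonneg fun i _ => h i

lemma tilt_min {lam v : Fin d → ℕ} {α : Fin d → ℝ}
    (hu : ∀ i, v i < lam i → α i ≤ 2 * v i + 1) (hl : ∀ i, 0 < v i → 2 * v i - 1 ≤ α i)
    {p : (Fin d → ℝ) × ℝ} (hp : p ∈ liftedPile lam) :
    tilt α (lift fun i => (v i : ℝ)) ≤ tilt α p := by
  refine le_of_mem_convexHull _ ?_ hp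
  rintro _ ⟨y, hy, rfl⟩
  exact (tilt_min_on_vertices hu hl hy).2

/-- A minimiser of a tilt lies in the convex hull of the minimal lattice points. -/
lemma mem_convexHull_of_tilt_eq {lam v : Fin d → ℕ} {α : Fin d → ℝ}
    (hu : ∀ i, v i < lam i → α i ≤ 2 * v i + 1) (hl : ∀ i, 0 < v i → 2 * v i - 1 ≤ α i)
    {p : (Fin d → ℝ) × ℝ} (hp : p ∈ liftedPile lam)
    (hpm : tilt α p = tilt α (lift fun i => (v i : ℝ))) :
    p ∈ convexHull ℝ
      (lift '' {y ∈ pileVertices lam | ∀ i, (y i - v i) * (y i + v i - α i) = 0}) := by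
  have h := mem_convexHull_face (tilt α) (S := lift '' pileVertices lam) (by
    rintro _ ⟨y, hy, rfl⟩
    exact (tilt_min_on_vertices hu hl hy).2) hp hpm
  refine convexHull_mono ?_ h
  rintro _ ⟨⟨y, hy, rfl⟩, hy2⟩
  refine ⟨y, ⟨hy, fun i => ?_⟩, rfl⟩
  rw [← sub_eq_zero, tilt_lift_sub,
    Finset.sum_eq_zero_iff_of_nonneg fun i _ => (tilt_min_on_vertices hu hl hy).1 i] at hy2
  exact hy2 i (Finset.mem_univ i)

/-- With slope 2v the excess of the tilt over its value at v is ∑ (y_i - v_i)² on lattice points: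
this is the tangent plane of the paraboloid at v. -/
lemma eq_of_tilt_vertex {lam v : Fin d → ℕ} {p : (Fin d → ℝ) × ℝ} (hp : p ∈ liftedPile lam)
    (hpm : tilt (fun i => 2 * (v i : ℝ)) p = tilt (fun i => 2 * (v i : ℝ)) (lift fun i => (v i : ℝ))) :
    p = lift fun i => (v i : ℝ) := by
  have h := mem_convexHull_of_tilt_eq (lam := lam) (v := v) (α := fun i => 2 * (v i : ℝ))
    (fun i _ => by linarith) (fun i _ => by linarith) hp hpm
  rw [← Set.mem_singleton_iff, ← convexHull_singleton (𝕜 := ℝ)]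
  refine convexHull_mono ?_ h
  rintro _ ⟨y, ⟨hy, h0⟩, rfl⟩
  rw [Set.mem_singleton_iff]
  congr 1
  funext i
  have := h0 i
  have h2 : (y i - v i) ^ 2 = 0 := by rw [← this]; ring
  nlinarith [pow_eq_zero_iff (two_ne_zero) |>.1 h2]

/-- The slope 2v + 1 in direction i₀ makes v and v + 1 tie there, while strictness fixes all other
coordinates; the minimal face lies in a unit edge. -/
lemma mem_segment_of_tilt_eq {lam v : Fin d → ℕ} {α : Fin d → ℝ} {i₀ : Fin d}
    (hα : α i₀ = 2 * v i₀ + 1)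
    (hu : ∀ i, i ≠ i₀ → v i < lam i → α i < 2 * v i + 1)
    (hl : ∀ i, i ≠ i₀ → 0 < v i → 2 * v i - 1 < α i)
    {p : (Fin d → ℝ) × ℝ} (hp : p ∈ liftedPile lam)
    (hpm : tilt α p = tilt α (lift fun i => (v i : ℝ))) :
    p ∈ segment ℝ (lift fun i => (v i : ℝ))
      (lift fun i => (v i : ℝ) + if i₀ = i then 1 else 0) := by
  have h := mem_convexHull_of_tilt_eq (lam := lam) (v := v) (α := α)
    (fun i hi => by
      by_cases h : i = i₀
      · rw [h, hα]
      · exact (hu i h hi).le)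
    (fun i hi => by
      by_cases h : i = i₀
      · rw [h, hα]
        linarith
      · exact (hl i h hi).le) hp hpm
  rw [← convexHull_pair]
  refine convexHull_mono ?_ h
  rintro _ ⟨y, ⟨hy, h0⟩, rfl⟩
  have hne : ∀ i, i ≠ i₀ → y i = v i := by
    intro i hi
    obtain ⟨z, hz⟩ := hy.2 i
    obtain ⟨h1, h2⟩ := hy.1 i
    have h3 := h0 i
    rw [hz] at h1 h2 h3 ⊢
    have := eq_of_mul_eq_zero_of_int (q := z) (v := v i) (L := lam i) (a := α i)
      (by exact_mod_cast h1)
      (by exact_mod_cast h2) (fun h => by exact_mod_cast hu i hi (by exact_mod_cast h))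
      (fun h => by exact_mod_cast hl i hi (by exact_mod_cast h)) (by exact_mod_cast h3)
    rw [this]
    simp
  have h1 := h0 i₀
  rw [hα] at h1
  rcases mul_eq_zero.1 h1 with h2 | h2
  · left
    congr 1
    funext i
    by_cases hi : i = i₀
    · rw [hi]
      linarith
    · exact hne i hi
  · right
    rw [Set.mem_singleton_iff]
    congr 1
    funext i
    by_cases hi : i = i₀
    · rw [hi, if_pos rfl]
      linarith
    · rw [hne i hi, if_neg (Ne.symm hi), add_zero]

lemma coordSum_mem_Icc {lam : Fin d → ℕ} (hsum : ∑ i, lam i = n) {p : (Fin d → ℝ) × ℝ}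
    (hp : p ∈ liftedPile lam) : coordSum p ∈ Set.Icc (0 : ℝ) n := by
  constructor
  · rw [← coordSumLinear_apply]
    refine le_of_mem_convexHull _ ?_ hp
    rintro _ ⟨y, hy, rfl⟩
    rw [coordSumLinear_apply]
    exact Finset.sum_nonneg fun i _ => (hy.1 i).1
  · have := le_of_mem_convexHull (-coordSumLinear) (m := -(n : ℝ)) (S := lift '' pileVertices lam) (by
      rintro _ ⟨y, hy, rfl⟩
      rw [LinearMap.neg_apply, coordSumLinear_apply, neg_le_neg_iff, ← hsum]
      push_cast
      exact Finset.sum_le_sum fun i _ => (hy.1 i).2) hp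
    rwa [LinearMap.neg_apply, coordSumLinear_apply, neg_le_neg_iff] at this

end Pile

/-! ### The lifted path of a word -/

section Path

variable {d n : ℕ}

lemma latticePath_eq (w : Fin n → Fin d) (k : Fin (n + 1)) :
    latticePath w k = fun i => (prefixCount w i k : ℝ) := funext fun i => latticePath_apply w k i

lemma liftedPath_eq (w : Fin n → Fin d) (k : Fin (n + 1)) :
    liftedPath w k = lift fun i => (prefixCount w i k : ℝ) := by
  rw [← latticePath_eq]
  rfl

lemma liftedPath_succ_eq (w : Fin n → Fin d) (k : Fin n) :
    liftedPath w k.succ =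
      lift fun i => (prefixCount w i k : ℝ) + if w k = i then 1 else 0 := by
  rw [liftedPath_eq]
  congr 1
  funext i
  rw [Fin.val_succ, prefixCount_succ]
  push_cast
  rfl

lemma liftedPath_succ (w : Fin n → Fin d) (k : Fin n) :
    liftedPath w k.succ = liftedPath w k.castSucc +
      (Pi.single (w k) 1, 2 * (prefixCount w (w k) k : ℝ) + 1) := by
  rw [liftedPath_succ_eq, liftedPath_eq]
  refine Prod.ext ?_ ?_
  · funext i
    simp only [lift, Fin.val_castSucc, Prod.mk_add_mk, Pi.add_apply, Pi.single_apply]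
    simp [eq_comm]
  · simp only [lift, sqSum, Fin.val_castSucc, Prod.mk_add_mk]
    have : ∀ i, ((prefixCount w i k : ℝ) + if w k = i then 1 else 0) ^ 2 =
        (prefixCount w i k : ℝ) ^ 2 + if w k = i then 2 * (prefixCount w i k : ℝ) + 1 else 0 := by
      intro i
      split_ifs <;> ring
    simp only [this, Finset.sum_add_distrib]
    simp

lemma liftedPath_mem {lam : Fin d → ℕ} {w : Fin n → Fin d} (hw : IsLambdaPerm lam w)
    (k : Fin (n + 1)) : liftedPath w k ∈ liftedPile lam := by
  rw [liftedPath_eq]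
  exact lift_mem (natCast_mem_pileVertices fun i => prefixCount_le hw i (by omega))

lemma coordSum_liftedPath (w : Fin n → Fin d) (k : Fin (n + 1)) :
    coordSum (liftedPath w k) = k := by
  rw [liftedPath_eq]
  simp only [coordSum, lift]
  exact_mod_cast sum_prefixCount w (by omega : (k : ℕ) ≤ n)

lemma convex_liftedPile (lam : Fin d → ℕ) : Convex ℝ (liftedPile lam) := convex_convexHull ℝ _

lemma liftedPath_injective : Function.Injective (liftedPath : (Fin n → Fin d) → _) := by
  intro w w' h
  have hc : ∀ i (k : ℕ), k ≤ n → prefixCount w i k = prefixCount w' i k := by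
    intro i k hk
    have := congrFun (congrArg Prod.fst (congrFun h ⟨k, Nat.lt_succ_of_le hk⟩)) i
    simp only [liftedPath_eq, lift] at this
    exact_mod_cast this
  funext k
  have h1 := prefixCount_succ w (w k) k
  have h2 := prefixCount_succ w' (w k) k
  rw [← hc _ _ k.2.le, ← hc _ _ k.2, h1] at h2
  by_contra hne
  rw [if_pos rfl, if_neg (Ne.symm hne)] at h2
  omega

lemma trace_eq_iUnion_segment {E : Type*} [NormedAddCommGroup E] [NormedSpace ℝ E]
    (hn : 0 < n) (p : Fin (n + 1) → E) :
    trace p = ⋃ k : Fin n, segment ℝ (p k.castSucc) (p k.succ) := by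
  unfold trace
  rw [Set.union_eq_right]
  rintro _ ⟨k, rfl⟩
  rw [Set.mem_iUnion]
  rcases Fin.eq_castSucc_or_eq_last k with ⟨j, rfl⟩ | rfl
  · exact ⟨j, left_mem_segment ℝ _ _⟩
  · refine ⟨⟨n - 1, by omega⟩, ?_⟩
    convert right_mem_segment ℝ _ _
    ext
    simp
    omega

lemma exists_step (hn : 0 < n) {t : ℝ} (ht : t ∈ Set.Icc (0 : ℝ) n) :
    ∃ k : Fin n, (k : ℝ) ≤ t ∧ t ≤ (k : ℝ) + 1 := by
  by_cases h : t < n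
  · refine ⟨⟨⌊t⌋₊, (Nat.floor_lt ht.1).2 h⟩, Nat.floor_le ht.1, (Nat.lt_floor_add_one t).le⟩
  · refine ⟨⟨n - 1, by omega⟩, ?_⟩
    have : ((n - 1 : ℕ) : ℝ) = n - 1 := by
      push_cast [Nat.cast_sub (Nat.succ_le_of_lt hn)]
      simp
    simp only [this]
    push Not at h
    have := ht.2
    constructor <;> linarith

/-- The functional of which the path of a word sorted by `x` is the minimiser. -/
def cost (x : Fin d → ℝ) : ((Fin d → ℝ) × ℝ) →ₗ[ℝ] ℝ := tilt fun i => -(2 * x i - 1)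

/-- Twice the value of the `k`-th letter. -/
def slope (x : Fin d → ℝ) (w : Fin n → Fin d) (k : Fin n) : ℝ :=
  2 * (x (w k) + (prefixCount w (w k) k : ℝ))

lemma cost_sub (x : Fin d → ℝ) (g : ℝ) (p : (Fin d → ℝ) × ℝ) :
    cost x p - g * coordSum p = tilt (fun i => g - (2 * x i - 1)) p :=
  (tilt_sub_const _ _ _).symm

/-- The -1 in `cost` cancels the 1 of (m + 1)² - m² = 2m + 1, so the slope is exactly twice the
sorted number. -/
lemma cost_liftedPath_succ (x : Fin d → ℝ) (w : Fin n → Fin d) (k : Fin n) :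
    cost x (liftedPath w k.succ) = cost x (liftedPath w k.castSucc) + slope x w k := by
  rw [liftedPath_succ, map_add, add_right_inj, cost, tilt_apply, slope]
  simp [Pi.single_apply]
  ring

/-- The line through the k-th step supports the image of the pile: steps not yet taken cost at least
`slope x w k`, those already taken at most that. Weak monotonicity suffices, so points on the
arrangement are covered. -/
lemma cost_ge_of_monotone {lam : Fin d → ℕ} {w : Fin n → Fin d} (hw : IsLambdaPerm lam w)
    {x : Fin d → ℝ} (hx : Monotone fun k => x (w k) + (prefixCount w (w k) k : ℝ)) (k : Fin n)
    {p : (Fin d → ℝ) × ℝ} (hp : p ∈ liftedPile lam) :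
    cost x (liftedPath w k.castSucc) - slope x w k * k ≤ cost x p - slope x w k * coordSum p := by
  have h1 := coordSum_liftedPath w k.castSucc
  rw [Fin.val_castSucc] at h1
  rw [← h1, cost_sub, cost_sub, liftedPath_eq]
  refine tilt_min ?_ ?_ hp
  · intro i hi
    rw [Fin.val_castSucc] at hi ⊢
    obtain ⟨q, hq1, hq2⟩ := hw.exists_occurrence hi
    have hkq : k ≤ q := by
      by_contra hlt
      push Not at hlt
      have := prefixCount_lt w (j := q) (k := k) hlt
      rw [hq1] at this
      omega
    have := hx hkq
    simp only [hq1, hq2] at this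
    rw [slope]
    linarith
  · intro i hi
    rw [Fin.val_castSucc] at hi ⊢
    obtain ⟨q, hq0, hq1, hq2⟩ := exists_occurrence w i
      (show prefixCount w i k - 1 < prefixCount w i k by omega)
    have := hx (show q ≤ k from le_of_lt hq0)
    simp only [hq1, hq2] at this
    rw [Nat.cast_sub hi] at this
    push_cast at this
    rw [slope]
    linarith

/-- In the region of w no other step has the same slope, so the supporting face is just the k-th
edge. -/
lemma mem_segment_of_cost_eq {lam : Fin d → ℕ} {w : Fin n → Fin d} (hw : IsLambdaPerm lam w)
    {x : Fin d → ℝ} (hx : x ∈ wordRegion w) (k : Fin n)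
    {p : (Fin d → ℝ) × ℝ} (hp : p ∈ liftedPile lam)
    (h : cost x p - slope x w k * coordSum p =
      cost x (liftedPath w k.castSucc) - slope x w k * k) :
    p ∈ segment ℝ (liftedPath w k.castSucc) (liftedPath w k.succ) := by
  have h1 := coordSum_liftedPath w k.castSucc
  rw [Fin.val_castSucc] at h1
  rw [← h1, cost_sub, cost_sub, liftedPath_eq] at h
  rw [liftedPath_succ_eq, liftedPath_eq]
  rw [mem_wordRegion] at hx
  refine mem_segment_of_tilt_eq ?_ ?_ ?_ hp h
  · rw [slope, Fin.val_castSucc]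
    ring
  · intro i hik hi
    rw [Fin.val_castSucc] at hi ⊢
    obtain ⟨q, hq1, hq2⟩ := hw.exists_occurrence hi
    have hkq : k < q := by
      by_contra hlt
      push Not at hlt
      rcases hlt.lt_or_eq with hlt | rfl
      · have := prefixCount_lt w (j := q) (k := k) hlt
        rw [hq1] at this
        omega
      · exact hik hq1.symm
    have := hx hkq
    simp only [hq1, hq2] at this
    rw [slope]
    linarith
  · intro i hik hi
    rw [Fin.val_castSucc] at hi ⊢
    obtain ⟨q, hq0, hq1, hq2⟩ := exists_occurrence w i
      (show prefixCount w i k - 1 < prefixCount w i k by omega)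
    have := hx (show q < k from hq0)
    simp only [hq1, hq2] at this
    rw [Nat.cast_sub hi] at this
    push_cast at this
    rw [slope]
    linarith

lemma cost_eq_of_mem_segment (x : Fin d → ℝ) (w : Fin n → Fin d) (k : Fin n)
    {p : (Fin d → ℝ) × ℝ} (hp : p ∈ segment ℝ (liftedPath w k.castSucc) (liftedPath w k.succ)) :
    cost x p - slope x w k * coordSum p =
      cost x (liftedPath w k.castSucc) - slope x w k * k := by
  obtain ⟨a, b, ha, hb, hab, rfl⟩ := hp
  rw [← coordSumLinear_apply]
  simp only [map_add, map_smul, coordSumLinear_apply, coordSum_liftedPath, cost_liftedPath_succ,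
    smul_eq_mul, Fin.val_castSucc, Fin.val_succ]
  obtain rfl : a = 1 - b := by linarith
  push_cast
  ring

/-- The point of the `k`-th edge at parameter `t`. -/
lemma exists_mem_segment (w : Fin n → Fin d) (k : Fin n) {t : ℝ} (h1 : (k : ℝ) ≤ t)
    (h2 : t ≤ (k : ℝ) + 1) :
    ∃ r ∈ segment ℝ (liftedPath w k.castSucc) (liftedPath w k.succ), coordSum r = t := by
  refine ⟨_, ⟨1 - (t - k), t - k, by linarith, by linarith, by ring, rfl⟩, ?_⟩
  rw [← coordSumLinear_apply]
  simp only [map_add, map_smul, coordSumLinear_apply, coordSum_liftedPath, smul_eq_mul,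
    Fin.val_castSucc, Fin.val_succ]
  push_cast
  ring

lemma eq_of_mem_segment (w : Fin n → Fin d) (k : Fin n) {p q : (Fin d → ℝ) × ℝ}
    (hp : p ∈ segment ℝ (liftedPath w k.castSucc) (liftedPath w k.succ))
    (hq : q ∈ segment ℝ (liftedPath w k.castSucc) (liftedPath w k.succ))
    (h : coordSum p = coordSum q) : p = q := by
  obtain ⟨a, b, ha, hb, hab, rfl⟩ := hp
  obtain ⟨a', b', ha', hb', hab', rfl⟩ := hq
  rw [← coordSumLinear_apply, ← coordSumLinear_apply] at h
  simp only [map_add, map_smul, coordSumLinear_apply, coordSum_liftedPath, smul_eq_mul,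
    Fin.val_castSucc, Fin.val_succ] at h
  obtain rfl : a = 1 - b := by linarith
  obtain rfl : a' = 1 - b' := by linarith
  push_cast at h
  obtain rfl : b = b' := by linarith
  rfl

lemma segment_subset_liftedPile {lam : Fin d → ℕ} {w : Fin n → Fin d} (hw : IsLambdaPerm lam w)
    (k : Fin n) : segment ℝ (liftedPath w k.castSucc) (liftedPath w k.succ) ⊆ liftedPile lam :=
  (convex_liftedPile lam).segment_subset (liftedPath_mem hw _) (liftedPath_mem hw _)

/-- A point of the pile which is minimal over its projection lies on the path. -/
lemma mem_segment_of_cost_le {lam : Fin d → ℕ} {w : Fin n → Fin d} (hw : IsLambdaPerm lam w)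
    {x : Fin d → ℝ} (hx : x ∈ wordRegion w) {k : Fin n} {p r : (Fin d → ℝ) × ℝ}
    (hp : p ∈ liftedPile lam)
    (hr : r ∈ segment ℝ (liftedPath w k.castSucc) (liftedPath w k.succ))
    (hpr : coordSum p = coordSum r) (h : cost x p ≤ cost x r) : p = r := by
  have h1 := cost_ge_of_monotone hw (mem_wordRegion.1 hx).monotone k hp
  rw [← cost_eq_of_mem_segment x w k hr, hpr] at h1
  refine eq_of_mem_segment w k (mem_segment_of_cost_eq hw hx k hp ?_) hr hpr
  rw [← cost_eq_of_mem_segment x w k hr, hpr]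
  linarith

end Path

/-! ### Coherence -/

section Coherence

variable {d n : ℕ}

lemma isExposed_of_linear {lam : Fin d → ℕ} (l : ((Fin d → ℝ) × ℝ) →ₗ[ℝ] ℝ) {m : ℝ}
    {B : Set ((Fin d → ℝ) × ℝ)} (hB : B ⊆ liftedPile lam) (hBm : ∀ p ∈ B, l p = m)
    (hle : ∀ p ∈ liftedPile lam, m ≤ l p) (hmem : ∀ p ∈ liftedPile lam, l p = m → p ∈ B) :
    IsExposed ℝ (liftedPile lam) B := by
  rintro ⟨b, hb⟩
  -- `IsExposed` refers to maximisers, hence the sign.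
  refine ⟨-LinearMap.toContinuousLinearMap l, ?_⟩
  ext p
  constructor
  · intro hp
    refine ⟨hB hp, fun y hy => ?_⟩
    have h1 := hBm p hp
    have h2 := hle y hy
    change -l y ≤ -l p
    linarith
  · rintro ⟨hp, h⟩
    refine hmem p hp (le_antisymm ?_ (hle p hp))
    have h1 : -l b ≤ -l p := h b (hB hb)
    have h2 := hBm b hb
    linarith

lemma lift_mem_extremePoints {lam v : Fin d → ℕ} (hv : ∀ i, v i ≤ lam i) :
    lift (fun i => (v i : ℝ)) ∈ (liftedPile lam).extremePoints ℝ := by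
  rw [← isExtreme_singleton]
  apply IsExposed.isExtreme
  refine isExposed_of_linear (tilt fun i => 2 * (v i : ℝ))
    (m := tilt (fun i => 2 * (v i : ℝ)) (lift fun i => (v i : ℝ))) ?_ ?_ ?_ ?_
  · rw [Set.singleton_subset_iff]
    exact lift_mem (natCast_mem_pileVertices hv)
  · intro p hp
    rw [Set.mem_singleton_iff.1 hp]
  · intro p hp
    exact tilt_min (fun i _ => by linarith) (fun i _ => by linarith) hp
  · intro p hp h
    exact eq_of_tilt_vertex hp h

lemma isMaxMonotoneEdgePath_liftedPath {lam : Fin d → ℕ} (hsum : ∑ i, lam i = n)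
    {w : Fin n → Fin d} (hw : IsLambdaPerm lam w) (hn : ¬ IsNesting w) :
    IsMaxMonotoneEdgePath (liftedPile lam) coordSum (liftedPath w) := by
  obtain ⟨x, hx⟩ := wordRegion_nonempty hn
  refine ⟨?_, ?_, ?_, ?_, ?_⟩
  · intro k
    rw [liftedPath_eq]
    exact lift_mem_extremePoints fun i => prefixCount_le hw i (by omega)
  · intro k
    have hlin : ∀ p, (cost x - slope x w k • coordSumLinear : _ →ₗ[ℝ] ℝ) p =
        cost x p - slope x w k * coordSum p := fun p => by
      simp [coordSumLinear_apply]
    refine isExposed_of_linear (cost x - slope x w k • coordSumLinear)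
      (segment_subset_liftedPile hw k) (fun p hp => ?_) (fun p hp => ?_) (fun p hp h => ?_)
      (m := cost x (liftedPath w k.castSucc) - slope x w k * k)
    · rw [hlin]
      exact cost_eq_of_mem_segment x w k hp
    · rw [hlin]
      exact cost_ge_of_monotone hw (mem_wordRegion.1 hx).monotone k hp
    · rw [hlin] at h
      exact mem_segment_of_cost_eq hw hx k hp h
  · intro k
    rw [coordSum_liftedPath, coordSum_liftedPath]
    simp
  · intro p hp
    rw [coordSum_liftedPath]
    simpa using (coordSum_mem_Icc hsum hp).1
  · intro p hp
    rw [coordSum_liftedPath]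
    exact (coordSum_mem_Icc hsum hp).2

/-- Points over the lower part of the polygon are the cheapest in their slice, and the cheapest
point of each slice is unique and lies on the path. -/
lemma isGeneric_cost {lam : Fin d → ℕ} (hn : 0 < n) (hsum : ∑ i, lam i = n)
    {w : Fin n → Fin d} (hw : IsLambdaPerm lam w) {x : Fin d → ℝ} (hx : x ∈ wordRegion w) :
    IsGeneric (liftedPile lam) coordSum (cost x) ∧
      planeMap coordSum (cost x) '' trace (liftedPath w) =
        lowerPart (planeMap coordSum (cost x) '' liftedPile lam) := by
  have hle : ∀ p ∈ liftedPile lam,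
      planeMap coordSum (cost x) p ∈ lowerPart (planeMap coordSum (cost x) '' liftedPile lam) →
      ∀ r ∈ liftedPile lam, coordSum p = coordSum r → cost x p ≤ cost x r := by
    intro p hp hlow r hr hpr
    by_contra hlt
    push Not at hlt
    refine hlow.2 (cost x p - cost x r) (by linarith) ⟨r, hr, ?_⟩
    simp [planeMap, hpr]
  have hpath : ∀ p ∈ liftedPile lam, ∃ k : Fin n,
      ∃ r ∈ segment ℝ (liftedPath w k.castSucc) (liftedPath w k.succ), coordSum r = coordSum p := by
    intro p hp
    obtain ⟨k, hk1, hk2⟩ := exists_step hn (coordSum_mem_Icc hsum hp)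
    exact ⟨k, exists_mem_segment w k hk1 hk2⟩
  constructor
  · rintro p ⟨hp, hplow⟩ q ⟨hq, hqlow⟩ hpq
    obtain ⟨h1, h2⟩ := Prod.mk.inj hpq
    obtain ⟨k, r, hr, hrp⟩ := hpath p hp
    have hrP := segment_subset_liftedPile hw k hr
    rw [mem_segment_of_cost_le hw hx hp hr hrp.symm (hle p hp hplow r hrP hrp.symm)]
    rw [mem_segment_of_cost_le hw hx hq hr (h1.symm.trans hrp.symm)
      (hle q hq hqlow r hrP (h1.symm.trans hrp.symm))]
  · rw [trace_eq_iUnion_segment hn]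
    apply Set.Subset.antisymm
    · rintro _ ⟨r, hr, rfl⟩
      obtain ⟨k, hr⟩ := Set.mem_iUnion.1 hr
      refine ⟨⟨r, segment_subset_liftedPile hw k hr, rfl⟩, ?_⟩
      rintro t ht ⟨p, hp, hpt⟩
      simp only [planeMap, Prod.mk.injEq] at hpt
      have := cost_ge_of_monotone hw (mem_wordRegion.1 hx).monotone k hp
      rw [← cost_eq_of_mem_segment x w k hr, hpt.1, hpt.2] at this
      linarith
    · intro q hq
      obtain ⟨p, hp, rfl⟩ := hq.1
      obtain ⟨k, r, hr, hrp⟩ := hpath p hp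
      have := mem_segment_of_cost_le hw hx hp hr hrp.symm
        (hle p hp hq r (segment_subset_liftedPile hw k hr) hrp.symm)
      rw [this]
      exact ⟨r, Set.mem_iUnion.2 ⟨k, hr⟩, rfl⟩

lemma isCoherent_of_not_isNesting {lam : Fin d → ℕ} (hn : 0 < n) (hsum : ∑ i, lam i = n)
    {w : Fin n → Fin d} (hw : IsLambdaPerm lam w) (hnest : ¬ IsNesting w) :
    IsCoherent (liftedPile lam) coordSum (liftedPath w) := by
  obtain ⟨x, hx⟩ := wordRegion_nonempty hnest
  exact ⟨isMaxMonotoneEdgePath_liftedPath hsum hw hnest, cost x, isGeneric_cost hn hsum hw hx⟩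

/-- The increments of c along γ^w have the form a_i + b m with b = 2c(0,1). Genericity makes them
strictly increasing, which contradicts `IsNesting.not_strictMono`. -/
lemma not_isNesting_of_isCoherent {lam : Fin d → ℕ} {w : Fin n → Fin d} (hw : IsLambdaPerm lam w)
    (h : IsCoherent (liftedPile lam) coordSum (liftedPath w)) : ¬ IsNesting w := by
  obtain ⟨hedge, c, hgen, hlow⟩ := h
  intro hnest
  have hdiff : ∀ k : Fin n, c (liftedPath w k.succ) - c (liftedPath w k.castSucc) =
      (c (Pi.single (w k) 1, 0) + c (0, 1)) + 2 * c (0, 1) * (prefixCount w (w k) k : ℝ) := by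
    intro k
    have : ((Pi.single (w k) (1 : ℝ) : Fin d → ℝ), 2 * (prefixCount w (w k) k : ℝ) + 1) =
        ((Pi.single (w k) (1 : ℝ) : Fin d → ℝ), (0 : ℝ)) +
          (2 * (prefixCount w (w k) k : ℝ) + 1) • ((0 : Fin d → ℝ), (1 : ℝ)) := by
      simp
    rw [liftedPath_succ, map_add, add_sub_cancel_left, this, map_add, map_smul, smul_eq_mul]
    ring
  refine hnest.not_strictMono (fun i => c (Pi.single i 1, 0) + c (0, 1)) (2 * c (0, 1)) ?_
  simp only [← hdiff]
  rcases n with _ | n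
  · intro i
    exact i.elim0
  rw [Fin.strictMono_iff_lt_succ]
  intro k
  have e : k.succ.castSucc = k.castSucc.succ := rfl
  rw [e]
  set a := liftedPath w k.castSucc.castSucc with ha
  set b := liftedPath w k.castSucc.succ with hb
  set b' := liftedPath w k.succ.succ with hb'
  have haP : a ∈ liftedPile lam := liftedPath_mem hw _
  have hb'P : b' ∈ liftedPile lam := liftedPath_mem hw _
  let mid : (Fin d → ℝ) × ℝ := (1 / 2 : ℝ) • a + (1 / 2 : ℝ) • b'
  have hmidP : mid ∈ liftedPile lam :=
    convex_liftedPile lam haP hb'P (by norm_num) (by norm_num) (by norm_num)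
  -- As b is a vertex, it is not the midpoint of its neighbours on the path. The midpoint has the
  -- same π-value, so genericity puts its image strictly above that of b.
  have hne : mid ≠ b := by
    intro hmb
    have h1 := (mem_extremePoints.1 (hedge.vertex k.castSucc.succ)).2 a haP b' hb'P
      ⟨1 / 2, 1 / 2, by norm_num, by norm_num, by norm_num, hmb⟩
    have h2 := hedge.increasing k.castSucc
    rw [← ha, ← hb] at h2
    rw [h1.1] at h2
    exact lt_irrefl _ h2
  have hblow : planeMap coordSum c b ∈ lowerPart (planeMap coordSum c '' liftedPile lam) := by
    rw [← hlow]
    exact ⟨b, Or.inl ⟨_, rfl⟩, rfl⟩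
  have hπ : coordSum mid = coordSum b := by
    rw [← coordSumLinear_apply]
    simp only [mid, map_add, map_smul, coordSumLinear_apply, a, b, b', coordSum_liftedPath,
      smul_eq_mul, Fin.val_castSucc, Fin.val_succ]
    push_cast
    ring
  have hc : c mid = (c a + c b') / 2 := by
    simp only [mid, map_add, map_smul, smul_eq_mul]
    ring
  have hlt : c b < c mid := by
    rcases lt_trichotomy (c b) (c mid) with h | h | h
    · exact h
    · exfalso
      have hpm : planeMap coordSum c mid = planeMap coordSum c b := by
        simp only [planeMap, hπ, h]
      refine hne (hgen ⟨hmidP, ?_⟩ ⟨liftedPath_mem hw _, hblow⟩ hpm)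
      rw [Set.mem_preimage, hpm]
      exact hblow
    · exfalso
      refine hblow.2 (c b - c mid) (by linarith) ⟨mid, hmidP, ?_⟩
      simp [planeMap, hπ]
  rw [hc] at hlt
  linarith

/-! ### Lower monotone edge paths come from words -/

/-- An edge in the lower part along which the coordinate sum increases is a unit step. -/
lemma exists_unit_step {lam : Fin d → ℕ} {u v : Fin d → ℝ} (hv : v ∈ pileVertices lam)
    (hu : u ∈ pileVertices lam) (hedge : IsExposed ℝ (liftedPile lam) (segment ℝ (lift v) (lift u)))
    (hlow : segment ℝ (lift v) (lift u) ⊆ lowerPart (liftedPile lam))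
    (hlt : coordSum (lift v) < coordSum (lift u)) : ∃ i, u = v + Pi.single i 1 := by
  obtain ⟨i, -, hi⟩ := Finset.exists_lt_of_sum_lt hlt
  simp only [lift] at hi
  obtain ⟨a, ha⟩ := hv.2 i
  obtain ⟨b, hb⟩ := hu.2 i
  have hab : a + 1 ≤ b := by
    rw [ha, hb] at hi
    exact_mod_cast hi
  have hab' : v i + 1 ≤ u i := by
    rw [ha, hb]
    exact_mod_cast hab
  -- Exchange argument: replacing v, u by v + e_i, u - e_i keeps the midpoint's base and lowers it
  -- by u_i - v_i - 1 ≥ 0. A positive drop leaves the lower part; a zero drop forces `lift v'` onto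
  -- the edge, where coordinate i identifies it with the endpoint u.
  set v' := v + Pi.single i 1 with hv'
  set u' := u - Pi.single i 1 with hu'
  have hv'i : ∀ j, v' j = v j + if j = i then 1 else 0 := fun j => by
    simp [hv', Pi.single_apply]
  have hu'i : ∀ j, u' j = u j - if j = i then 1 else 0 := fun j => by
    simp [hu', Pi.single_apply]
  have hv'P : v' ∈ pileVertices lam := by
    refine ⟨fun j => ?_, fun j => ?_⟩
    · rw [hv'i]
      split_ifs with h
      · rw [h]
        exact ⟨by linarith [(hv.1 i).1], by linarith [(hu.1 i).2]⟩
      · simpa using hv.1 j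
    · obtain ⟨z, hz⟩ := hv.2 j
      rw [hv'i, hz]
      split_ifs
      · exact ⟨z + 1, by push_cast; rfl⟩
      · exact ⟨z, by simp⟩
  have hu'P : u' ∈ pileVertices lam := by
    refine ⟨fun j => ?_, fun j => ?_⟩
    · rw [hu'i]
      split_ifs with h
      · rw [h]
        exact ⟨by linarith [(hv.1 i).1], by linarith [(hu.1 i).2]⟩
      · simpa using hu.1 j
    · obtain ⟨z, hz⟩ := hu.2 j
      rw [hu'i, hz]
      split_ifs
      · exact ⟨z - 1, by push_cast; rfl⟩
      · exact ⟨z, by simp⟩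
  have hsq : sqSum v' + sqSum u' = sqSum v + sqSum u - 2 * (u i - v i - 1) := by
    have h1 : ∀ j, v' j ^ 2 = v j ^ 2 + if j = i then 2 * v i + 1 else 0 := by
      intro j
      rw [hv'i]
      split_ifs with h
      · rw [h]
        ring
      · ring
    have h2 : ∀ j, u' j ^ 2 = u j ^ 2 + if j = i then 1 - 2 * u i else 0 := by
      intro j
      rw [hu'i]
      split_ifs with h
      · rw [h]
        ring
      · ring
    simp only [sqSum, h1, h2, Finset.sum_add_distrib]
    simp only [Finset.sum_ite_eq', Finset.mem_univ, if_true]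
    ring
  have hmid : (1 / 2 : ℝ) • lift v' + (1 / 2 : ℝ) • lift u' =
      (((1 / 2 : ℝ) • lift v + (1 / 2 : ℝ) • lift u).1,
        ((1 / 2 : ℝ) • lift v + (1 / 2 : ℝ) • lift u).2 - (u i - v i - 1)) := by
    refine Prod.ext ?_ ?_
    · simp only [lift, hv', hu', Prod.smul_mk, Prod.mk_add_mk]
      module
    · simp only [lift, Prod.smul_mk, Prod.mk_add_mk, smul_eq_mul]
      linarith
  have hmemseg : (1 / 2 : ℝ) • lift v + (1 / 2 : ℝ) • lift u ∈ segment ℝ (lift v) (lift u) :=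
    ⟨1 / 2, 1 / 2, by norm_num, by norm_num, by norm_num, rfl⟩
  have hmidP : (1 / 2 : ℝ) • lift v' + (1 / 2 : ℝ) • lift u' ∈ liftedPile lam :=
    convex_liftedPile lam (lift_mem hv'P) (lift_mem hu'P) (by norm_num) (by norm_num) (by norm_num)
  rcases hab'.lt_or_eq with h | h
  · exfalso
    rw [hmid] at hmidP
    exact (hlow hmemseg).2 _ (by linarith) hmidP
  · refine ⟨i, ?_⟩
    rw [show u i - v i - 1 = 0 by linarith, sub_zero] at hmid
    have hopen : (1 / 2 : ℝ) • lift v + (1 / 2 : ℝ) • lift u ∈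
        openSegment ℝ (lift v') (lift u') :=
      ⟨1 / 2, 1 / 2, by norm_num, by norm_num, by norm_num, hmid⟩
    have hmem := hedge.isExtreme.left_mem_of_mem_openSegment (lift_mem hv'P) (lift_mem hu'P)
      hmemseg hopen
    obtain ⟨p, q, hp, hq, hpq, he⟩ := hmem
    have h1 := congrArg Prod.fst he
    simp only [lift, Prod.smul_mk, Prod.mk_add_mk] at h1
    have h2 := congrFun h1 i
    rw [hv'i, if_pos rfl, Pi.add_apply, Pi.smul_apply, Pi.smul_apply, ← h, smul_eq_mul,
      smul_eq_mul] at h2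
    obtain rfl : p = 1 - q := by linarith
    obtain rfl : q = 1 := by linarith
    simpa using h1

lemma mem_pileVertices_of_extreme {lam : Fin d → ℕ} {p : (Fin d → ℝ) × ℝ}
    (hp : p ∈ (liftedPile lam).extremePoints ℝ) : ∃ v ∈ pileVertices lam, lift v = p := by
  have h : p ∈ lift '' pileVertices lam := extremePoints_convexHull_subset hp
  exact h

/-- A maximal monotone edge path in the lower part is the lifted path of a word. -/
lemma exists_word_of_path {lam : Fin d → ℕ} (hsum : ∑ i, lam i = n)
    {p : Σ m : ℕ, Fin (m + 1) → (Fin d → ℝ) × ℝ} (hp : p ∈ liftedMonotonePaths lam) :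
    ∃ w : Fin n → Fin d, IsLambdaPerm lam w ∧ p = ⟨n, liftedPath w⟩ := by
  obtain ⟨m, p⟩ := p
  obtain ⟨hmax, htr⟩ := hp
  simp only at hmax htr
  choose v hv hvp using fun k => mem_pileVertices_of_extreme (hmax.vertex k)
  have hstep : ∀ k : Fin m, ∃ i, v k.succ = v k.castSucc + Pi.single i 1 := by
    intro k
    apply exists_unit_step (hv _) (hv _)
    · rw [hvp, hvp]
      exact hmax.edge k
    · rw [hvp, hvp]
      exact (Set.subset_iUnion _ k).trans (Set.subset_union_right.trans htr)
    · rw [hvp, hvp]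
      exact hmax.increasing k
  choose w hw using hstep
  have h0 : v 0 = 0 := by
    have h1 := hmax.start (lift fun i => ((0 : ℕ) : ℝ))
      (lift_mem (natCast_mem_pileVertices (v := 0) fun i => Nat.zero_le _))
    rw [← hvp] at h1
    simp only [coordSum, lift, Nat.cast_zero, Finset.sum_const_zero] at h1
    have h2 := (Finset.sum_eq_zero_iff_of_nonneg fun i _ => ((hv 0).1 i).1).1
      (le_antisymm h1 (Finset.sum_nonneg fun i _ => ((hv 0).1 i).1))
    funext i
    exact h2 i (Finset.mem_univ _)
  have hvw : ∀ k : Fin (m + 1), v k = fun i => (prefixCount w i k : ℝ) := by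
    intro k
    induction k using Fin.induction with
    | zero => simp [h0]; rfl
    | succ k ih =>
      rw [hw, ih]
      funext i
      rw [Fin.val_succ, prefixCount_succ, Pi.add_apply, Pi.single_apply]
      push_cast
      simp [eq_comm]
  have hlast : ∀ i, v (Fin.last m) i = lam i := by
    have h1 := hmax.finish (lift fun i => (lam i : ℝ))
      (lift_mem (natCast_mem_pileVertices fun i => le_rfl))
    rw [← hvp] at h1
    simp only [coordSum, lift] at h1
    have h2 := (Finset.sum_eq_sum_iff_of_le fun i _ => ((hv (Fin.last m)).1 i).2).1
      (le_antisymm (Finset.sum_le_sum fun i _ => ((hv (Fin.last m)).1 i).2) h1)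
    exact fun i => h2 i (Finset.mem_univ _)
  have hcount : ∀ i, prefixCount w i m = lam i := by
    intro i
    have := hlast i
    simp only [hvw, Fin.val_last] at this
    exact_mod_cast this
  have hmn : m = n := by
    rw [← hsum, ← sum_prefixCount w le_rfl]
    exact Finset.sum_congr rfl fun i _ => hcount i
  subst hmn
  refine ⟨w, fun i => ?_, ?_⟩
  · rw [← hcount]
    simp [prefixCount]
  · congr 1
    funext k
    rw [← hvp, hvw, liftedPath_eq]

/-- `cost x` has coefficient 1 on the height, so a downward move violates the supporting inequality
of the edge. -/
lemma trace_liftedPath_subset {lam : Fin d → ℕ} (hn : 0 < n)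
    {w : Fin n → Fin d} (hw : IsLambdaPerm lam w) (hnest : ¬ IsNesting w) :
    trace (liftedPath w) ⊆ lowerPart (liftedPile lam) := by
  obtain ⟨x, hx⟩ := wordRegion_nonempty hnest
  rw [trace_eq_iUnion_segment hn]
  intro p hp
  obtain ⟨k, hp⟩ := Set.mem_iUnion.1 hp
  refine ⟨segment_subset_liftedPile hw k hp, fun t ht hmem => ?_⟩
  have h1 := cost_ge_of_monotone hw (mem_wordRegion.1 hx).monotone k hmem
  rw [← cost_eq_of_mem_segment x w k hp] at h1
  have h2 : coordSum (p.1, p.2 - t) = coordSum p := rfl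
  have h3 : cost x (p.1, p.2 - t) = cost x p - t := by
    simp only [cost, tilt_apply]
    ring
  rw [h2, h3] at h1
  linarith

theorem coherent_paths_eq {lam : Fin d → ℕ} (hn : 0 < n) (hsum : ∑ i, lam i = n) :
    {p ∈ liftedMonotonePaths lam | IsCoherent (liftedPile lam) coordSum p.2} =
      (fun w : Fin n → Fin d =>
        (⟨n, liftedPath w⟩ : Σ m : ℕ, Fin (m + 1) → (Fin d → ℝ) × ℝ)) ''
        {w : Fin n → Fin d | IsLambdaPerm lam w ∧ ¬ IsNesting w} := by
  ext p
  constructor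
  · rintro ⟨hp, hc⟩
    obtain ⟨w, hw, rfl⟩ := exists_word_of_path hsum hp
    exact ⟨w, ⟨hw, not_isNesting_of_isCoherent hw hc⟩, rfl⟩
  · rintro ⟨w, ⟨hw, hnest⟩, rfl⟩
    exact ⟨⟨isMaxMonotoneEdgePath_liftedPath hsum hw hnest, trace_liftedPath_subset hn hw hnest⟩,
      isCoherent_of_not_isNesting hn hsum hw hnest⟩

theorem ncard_coherent_paths {lam : Fin d → ℕ} (hn : 0 < n) (hsum : ∑ i, lam i = n) :
    {p ∈ liftedMonotonePaths lam | IsCoherent (liftedPile lam) coordSum p.2}.ncard =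
      {w : Fin n → Fin d | IsLambdaPerm lam w ∧ ¬ IsNesting w}.ncard := by
  rw [coherent_paths_eq hn hsum]
  refine Set.ncard_image_of_injective _ fun w w' h => liftedPath_injective ?_
  simpa using h

end Coherence

open MeasureTheory

/-! ### The monotone path polytope -/

section PathPolytope

variable {d n : ℕ}

/-- The lifted path of a word, parametrised by the coordinate sum. -/
def pathSection (w : Fin n → Fin d) (t : ℝ) : (Fin d → ℝ) × ℝ :=
  ∑ k : Fin n, max 0 (min 1 (t - (k : ℕ))) • (liftedPath w k.succ - liftedPath w k.castSucc)

lemma continuous_pathSection (w : Fin n → Fin d) : Continuous (pathSection w) := by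
  unfold pathSection
  fun_prop

/-- The sum telescopes without a base point because the path starts at the origin. -/
lemma sum_steps (w : Fin n → Fin d) (k : Fin (n + 1)) :
    ∑ j : Fin n, (if j.castSucc < k then liftedPath w j.succ - liftedPath w j.castSucc else 0) =
      liftedPath w k := by
  induction k using Fin.induction with
  | zero =>
    rw [liftedPath_eq]
    simp only [Fin.not_lt_zero, if_false, Finset.sum_const_zero]
    simp only [Fin.val_zero, prefixCount_zero, Nat.cast_zero, lift, sqSum]
    simp only [ne_eq, OfNat.ofNat_ne_zero, not_false_eq_true, zero_pow, Finset.sum_const_zero]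
    rfl
  | succ k ih =>
    have : ∀ j : Fin n,
        (if j.castSucc < k.succ then liftedPath w j.succ - liftedPath w j.castSucc else 0) =
        (if j.castSucc < k.castSucc then liftedPath w j.succ - liftedPath w j.castSucc else 0) +
          if j = k then liftedPath w j.succ - liftedPath w j.castSucc else 0 := by
      intro j
      rcases lt_trichotomy j k with h | h | h
      · have h1 : j.castSucc < k.succ := Fin.castSucc_lt_succ_iff.2 h.le
        have h2 : j.castSucc < k.castSucc := h
        rw [if_pos h1, if_pos h2, if_neg h.ne, add_zero]
      · subst h
        rw [if_pos Fin.castSucc_lt_succ, if_neg (lt_irrefl _), if_pos rfl, zero_add]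
      · have h1 : ¬ j.castSucc < k.succ := by rw [Fin.castSucc_lt_succ_iff]; exact not_le.2 h
        have h2 : ¬ j.castSucc < k.castSucc := not_lt.2 (le_of_lt h)
        rw [if_neg h1, if_neg h2, if_neg h.ne', add_zero]
    simp only [this, Finset.sum_add_distrib, ih]
    simp

/-- For t in [k, k + 1] the clamped weights are 1 before step k, t - k at it and 0 after it. -/
lemma pathSection_eq (w : Fin n → Fin d) (k : Fin n) {t : ℝ} (h1 : (k : ℝ) ≤ t)
    (h2 : t ≤ (k : ℝ) + 1) :
    pathSection w t = liftedPath w k.castSucc +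
      (t - k) • (liftedPath w k.succ - liftedPath w k.castSucc) := by
  have : ∀ j : Fin n,
      max 0 (min 1 (t - (j : ℕ))) • (liftedPath w j.succ - liftedPath w j.castSucc) =
      (if j.castSucc < k.castSucc then liftedPath w j.succ - liftedPath w j.castSucc else 0) +
        if j = k then (t - k) • (liftedPath w j.succ - liftedPath w j.castSucc) else 0 := by
    intro j
    rcases lt_trichotomy j k with h | h | h
    · have h3 : j.castSucc < k.castSucc := h
      have h4 : ((j : ℕ) : ℝ) + 1 ≤ (k : ℕ) := by exact_mod_cast h
      rw [if_pos h3, if_neg h.ne, min_eq_left (by linarith), max_eq_right zero_le_one, one_smul,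
        add_zero]
    · subst h
      rw [if_neg (lt_irrefl _), if_pos rfl, zero_add, min_eq_right (by linarith),
        max_eq_right (by linarith)]
    · have h3 : ¬ j.castSucc < k.castSucc := not_lt.2 (le_of_lt h)
      have h4 : ((k : ℕ) : ℝ) + 1 ≤ (j : ℕ) := by exact_mod_cast h
      rw [if_neg h3, if_neg h.ne', max_eq_left ((min_le_right _ _).trans (by linarith)), zero_smul,
        add_zero]
  simp only [pathSection, this, Finset.sum_add_distrib, sum_steps]
  simp

lemma pathSection_mem_segment (w : Fin n → Fin d) (k : Fin n) {t : ℝ} (h1 : (k : ℝ) ≤ t)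
    (h2 : t ≤ (k : ℝ) + 1) :
    pathSection w t ∈ segment ℝ (liftedPath w k.castSucc) (liftedPath w k.succ) := by
  rw [pathSection_eq w k h1 h2]
  refine ⟨1 - (t - k), t - k, by linarith, by linarith, by ring, ?_⟩
  module

lemma coordSum_pathSection (w : Fin n → Fin d) (hn : 0 < n) {t : ℝ} (ht : t ∈ Set.Icc (0 : ℝ) n) :
    coordSum (pathSection w t) = t := by
  obtain ⟨k, h1, h2⟩ := exists_step hn ht
  rw [pathSection_eq w k h1 h2, ← coordSumLinear_apply]
  simp only [map_add, map_smul, map_sub, coordSumLinear_apply, coordSum_liftedPath, smul_eq_mul,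
    Fin.val_castSucc, Fin.val_succ]
  push_cast
  ring

lemma pathSection_mem {lam : Fin d → ℕ} (hn : 0 < n) {w : Fin n → Fin d} (hw : IsLambdaPerm lam w)
    {t : ℝ} (ht : t ∈ Set.Icc (0 : ℝ) n) : pathSection w t ∈ liftedPile lam := by
  obtain ⟨k, h1, h2⟩ := exists_step hn ht
  exact segment_subset_liftedPile hw k (pathSection_mem_segment w k h1 h2)

lemma pathSection_natCast (w : Fin n → Fin d) (hn : 0 < n) (k : Fin (n + 1)) :
    pathSection w (k : ℕ) = liftedPath w k := by
  rcases Fin.eq_castSucc_or_eq_last k with ⟨j, rfl⟩ | rfl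
  · rw [pathSection_eq w j (by simp) (by simp)]
    simp
  · let j : Fin n := ⟨n - 1, by omega⟩
    have hj : ((j : ℕ) : ℝ) = n - 1 := by
      simp only [j]
      push_cast [Nat.cast_sub (Nat.succ_le_of_lt hn)]
      simp
    have hjs : j.succ = Fin.last n := by
      ext
      simp [j]
      omega
    rw [Fin.val_last, pathSection_eq w j (by linarith) (by linarith), hj, hjs]
    module

/-! ### Averages of sections and lower vertices -/

/-- The sections of the projection of the lifted pile. -/
def IsSection (n : ℕ) (lam : Fin d → ℕ) (γ : ℝ → (Fin d → ℝ) × ℝ) : Prop :=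
  ContinuousOn γ (Set.Icc (0 : ℝ) n) ∧
    ∀ t ∈ Set.Icc (0 : ℝ) n, γ t ∈ liftedPile lam ∧ coordSum (γ t) = t

/-- The average of a path over `[0, n]`. -/
def average (n : ℕ) (γ : ℝ → (Fin d → ℝ) × ℝ) : (Fin d → ℝ) × ℝ :=
  (n : ℝ)⁻¹ • ∫ t in Set.Icc (0 : ℝ) n, γ t

lemma isSection_pathSection {lam : Fin d → ℕ} (hn : 0 < n) {w : Fin n → Fin d}
    (hw : IsLambdaPerm lam w) : IsSection n lam (pathSection w) :=
  ⟨(continuous_pathSection w).continuousOn, fun _ ht =>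
    ⟨pathSection_mem hn hw ht, coordSum_pathSection w hn ht⟩⟩

lemma coordSum_image {lam : Fin d → ℕ} (hn : 0 < n) (hsum : ∑ i, lam i = n) :
    coordSum '' liftedPile lam = Set.Icc (0 : ℝ) n := by
  apply Set.Subset.antisymm
  · rintro _ ⟨p, hp, rfl⟩
    exact coordSum_mem_Icc hsum hp
  · intro t ht
    obtain ⟨w, hw, -⟩ := exists_sorted_word hsum 0
    exact ⟨pathSection w t, pathSection_mem hn hw ht, coordSum_pathSection w hn ht⟩

lemma pathPolytope_eq {lam : Fin d → ℕ} (hn : 0 < n) (hsum : ∑ i, lam i = n) :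
    pathPolytope lam = {y | ∃ γ, IsSection n lam γ ∧ y = average n γ} := by
  have hv : volume.real (Set.Icc (0 : ℝ) n) = n := by
    rw [Real.volume_real_Icc_of_le (Nat.cast_nonneg n), sub_zero]
  simp only [pathPolytope, monotonePathPolytope, coordSum_image hn hsum, hv, IsSection, average,
    and_assoc]

lemma IsSection.integrableOn {lam : Fin d → ℕ} {γ : ℝ → (Fin d → ℝ) × ℝ} (h : IsSection n lam γ) :
    IntegrableOn γ (Set.Icc (0 : ℝ) n) := h.1.integrableOn_Icc

lemma map_average {lam : Fin d → ℕ} {γ : ℝ → (Fin d → ℝ) × ℝ} (h : IsSection n lam γ)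
    (l : ((Fin d → ℝ) × ℝ) →ₗ[ℝ] ℝ) :
    l (average n γ) = (n : ℝ)⁻¹ * ∫ t in Set.Icc (0 : ℝ) n, l (γ t) := by
  rw [average, map_smul, smul_eq_mul]
  congr 1
  exact ((LinearMap.toContinuousLinearMap l).integral_comp_comm h.integrableOn).symm

lemma IsSection.integrableOn_linear {lam : Fin d → ℕ} {γ : ℝ → (Fin d → ℝ) × ℝ}
    (h : IsSection n lam γ) (l : ((Fin d → ℝ) × ℝ) →ₗ[ℝ] ℝ) :
    IntegrableOn (fun t => l (γ t)) (Set.Icc (0 : ℝ) n) :=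
  (LinearMap.toContinuousLinearMap l).integrable_comp h.integrableOn

lemma convex_pathPolytope {lam : Fin d → ℕ} (hn : 0 < n) (hsum : ∑ i, lam i = n) :
    Convex ℝ (pathPolytope lam) := by
  rw [pathPolytope_eq hn hsum]
  rintro _ ⟨γ, hγ, rfl⟩ _ ⟨γ', hγ', rfl⟩ a b ha hb hab
  refine ⟨fun t => a • γ t + b • γ' t, ⟨?_, fun t ht => ⟨?_, ?_⟩⟩, ?_⟩
  · exact (hγ.1.const_smul a).add (hγ'.1.const_smul b)
  · exact convex_liftedPile lam (hγ.2 t ht).1 (hγ'.2 t ht).1 ha hb hab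
  · rw [← coordSumLinear_apply]
    simp only [map_add, map_smul, coordSumLinear_apply, (hγ.2 t ht).2, (hγ'.2 t ht).2, smul_eq_mul]
    rw [← add_mul, hab, one_mul]
  · simp only [average]
    have h : ∫ t in Set.Icc (0 : ℝ) n, (a • γ t + b • γ' t) =
        (∫ t in Set.Icc (0 : ℝ) n, a • γ t) + ∫ t in Set.Icc (0 : ℝ) n, b • γ' t :=
      integral_add (hγ.integrableOn.smul a) (hγ'.integrableOn.smul b)
    rw [h, integral_smul, integral_smul]
    module

lemma cost_pathSection_le {lam : Fin d → ℕ} (hn : 0 < n) {w : Fin n → Fin d}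
    (hw : IsLambdaPerm lam w) {x : Fin d → ℝ}
    (hx : Monotone fun k => x (w k) + (prefixCount w (w k) k : ℝ))
    {γ : ℝ → (Fin d → ℝ) × ℝ} (h : IsSection n lam γ) {t : ℝ} (ht : t ∈ Set.Icc (0 : ℝ) n) :
    cost x (pathSection w t) ≤ cost x (γ t) := by
  obtain ⟨k, h1, h2⟩ := exists_step hn ht
  have h3 := cost_ge_of_monotone hw hx k (h.2 t ht).1
  rw [← cost_eq_of_mem_segment x w k (pathSection_mem_segment w k h1 h2), (h.2 t ht).2,
    coordSum_pathSection w hn ht] at h3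
  linarith

lemma cost_average_le {lam : Fin d → ℕ} (hn : 0 < n) {w : Fin n → Fin d}
    (hw : IsLambdaPerm lam w) {x : Fin d → ℝ}
    (hx : Monotone fun k => x (w k) + (prefixCount w (w k) k : ℝ))
    {γ : ℝ → (Fin d → ℝ) × ℝ} (h : IsSection n lam γ) :
    cost x (average n (pathSection w)) ≤ cost x (average n γ) := by
  have hs := isSection_pathSection hn hw
  rw [map_average h, map_average hs]
  refine mul_le_mul_of_nonneg_left ?_ (by positivity)
  exact setIntegral_mono_on (hs.integrableOn_linear _) (h.integrableOn_linear _) measurableSet_Icc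
    fun t ht => cost_pathSection_le hn hw hx h ht

/-- A section whose average is as cheap as that of a path in the region of a word is that path. -/
lemma eqOn_pathSection {lam : Fin d → ℕ} (hn : 0 < n) {w : Fin n → Fin d}
    (hw : IsLambdaPerm lam w) {x : Fin d → ℝ} (hx : x ∈ wordRegion w)
    {γ : ℝ → (Fin d → ℝ) × ℝ} (h : IsSection n lam γ)
    (hle : cost x (average n γ) ≤ cost x (average n (pathSection w))) :
    Set.EqOn γ (pathSection w) (Set.Icc (0 : ℝ) n) := by
  have hmono := (mem_wordRegion.1 hx).monotone
  have hs := isSection_pathSection hn hw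
  have hn' : (0 : ℝ) < n := by exact_mod_cast hn
  rw [map_average h, map_average hs] at hle
  have hle' := le_of_mul_le_mul_left hle (inv_pos.2 hn')
  have hint := (h.integrableOn_linear (cost x)).sub (hs.integrableOn_linear (cost x))
  have hnonneg : 0 ≤ᵐ[volume.restrict (Set.Icc (0 : ℝ) n)]
      fun t => cost x (γ t) - cost x (pathSection w t) := by
    filter_upwards [ae_restrict_mem measurableSet_Icc] with t ht
    exact sub_nonneg.2 (cost_pathSection_le hn hw hmono h ht)
  have hzero : ∫ t in Set.Icc (0 : ℝ) n, (cost x (γ t) - cost x (pathSection w t)) = 0 := by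
    refine le_antisymm ?_ (integral_nonneg_of_ae hnonneg)
    rw [integral_sub (h.integrableOn_linear _) (hs.integrableOn_linear _)]
    linarith
  have hae := (setIntegral_eq_zero_iff_of_nonneg_ae hnonneg hint).1 hzero
  -- The nonnegative cost difference has integral zero, so it vanishes almost everywhere; there,
  -- unique slice minimisers give equal points, and continuity extends this to the interval.
  refine Measure.eqOn_Icc_of_ae_eq volume hn'.ne ?_ h.1 hs.1
  filter_upwards [hae, ae_restrict_mem measurableSet_Icc] with t h0 ht
  obtain ⟨k, h1, h2⟩ := exists_step hn ht
  refine mem_segment_of_cost_le hw hx (h.2 t ht).1 (pathSection_mem_segment w k h1 h2) ?_ ?_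
  · rw [(h.2 t ht).2, coordSum_pathSection w hn ht]
  · simp only [Pi.zero_apply] at h0
    linarith

lemma average_congr {γ γ' : ℝ → (Fin d → ℝ) × ℝ} (h : Set.EqOn γ γ' (Set.Icc (0 : ℝ) n)) :
    average n γ = average n γ' := by
  rw [average, average, setIntegral_congr_fun measurableSet_Icc h]

/-- Equal averages have equal cost, so the two sections coincide; their values at integers are the
vertices of the paths, which determine the words. -/
lemma average_injOn {lam : Fin d → ℕ} (hn : 0 < n) :
    Set.InjOn (fun w : Fin n → Fin d => average n (pathSection w))
      {w : Fin n → Fin d | IsLambdaPerm lam w ∧ ¬ IsNesting w} := by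
  rintro w ⟨hw, hnest⟩ w' ⟨hw', -⟩ h
  obtain ⟨x, hx⟩ := wordRegion_nonempty hnest
  have h1 := eqOn_pathSection hn hw hx (isSection_pathSection hn hw')
    (le_of_eq (congrArg (cost x) h.symm))
  apply liftedPath_injective
  funext k
  rw [← pathSection_natCast w hn, ← pathSection_natCast w' hn]
  exact (h1 ⟨Nat.cast_nonneg _, Nat.cast_le.2 (by omega)⟩).symm

/-- The average is the unique minimiser of `cost x`, hence extreme, and `cost x` decreases under
downward moves. -/
lemma average_mem_lowerVertices {lam : Fin d → ℕ} (hn : 0 < n) (hsum : ∑ i, lam i = n)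
    {w : Fin n → Fin d} (hw : IsLambdaPerm lam w) (hnest : ¬ IsNesting w) :
    average n (pathSection w) ∈ lowerVertices lam := by
  obtain ⟨x, hx⟩ := wordRegion_nonempty hnest
  have hmono := (mem_wordRegion.1 hx).monotone
  have hmem : average n (pathSection w) ∈ pathPolytope lam := by
    rw [pathPolytope_eq hn hsum]
    exact ⟨_, isSection_pathSection hn hw, rfl⟩
  have hmin : ∀ y ∈ pathPolytope lam, cost x (average n (pathSection w)) ≤ cost x y := by
    rw [pathPolytope_eq hn hsum]
    rintro _ ⟨γ, hγ, rfl⟩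
    exact cost_average_le hn hw hmono hγ
  have huniq : ∀ y ∈ pathPolytope lam, cost x y ≤ cost x (average n (pathSection w)) →
      y = average n (pathSection w) := by
    rw [pathPolytope_eq hn hsum]
    rintro _ ⟨γ, hγ, rfl⟩ hle
    exact average_congr (eqOn_pathSection hn hw hx hγ hle)
  refine ⟨mem_extremePoints.2 ⟨hmem, ?_⟩, hmem, ?_⟩
  · rintro y hy z hz ⟨a, b, ha, hb, hab, he⟩
    have h1 := hmin y hy
    have h2 := hmin z hz
    have h3 := congrArg (cost x) he
    simp only [map_add, map_smul, smul_eq_mul] at h3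
    obtain rfl : a = 1 - b := by linarith
    refine ⟨huniq y hy ?_, huniq z hz ?_⟩
    · nlinarith
    · nlinarith
  · intro t ht hlow
    have h1 := hmin _ hlow
    have h2 : ∀ p : (Fin d → ℝ) × ℝ, cost x (p.1, p.2 - t) = cost x p - t := by
      intro p
      simp only [cost, tilt_apply]
      ring
    rw [h2] at h1
    linarith

/-- A linear functional which increases vertically is bounded below on the path polytope by its
value at the average of the path of some nonnesting word. -/
lemma exists_average_le {lam : Fin d → ℕ} (hn : 0 < n) (hsum : ∑ i, lam i = n)
    (l : ((Fin d → ℝ) × ℝ) →ₗ[ℝ] ℝ) (hl : 0 < l (0, 1)) :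
    ∃ w : Fin n → Fin d, (IsLambdaPerm lam w ∧ ¬ IsNesting w) ∧
      ∀ y ∈ pathPolytope lam, l (average n (pathSection w)) ≤ l y := by
  -- Chosen so that l = l(0,1) · `cost x`, that is, 2 x_i - 1 = l(e_i)/l(0,1). This x may lie on the
  -- arrangement, so the word comes from the tie-breaking sort.
  let x : Fin d → ℝ := fun i => (l (Pi.single i 1, 0) / l (0, 1) + 1) / 2
  have hlx : ∀ p, l p = l (0, 1) * cost x p := by
    intro p
    have h1 : p = ∑ i, p.1 i • ((Pi.single i (1 : ℝ) : Fin d → ℝ), (0 : ℝ)) +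
        p.2 • ((0 : Fin d → ℝ), (1 : ℝ)) := by
      refine Prod.ext ?_ ?_
      · simp only [Prod.smul_mk, Prod.fst_add, Prod.fst_sum]
        rw [smul_zero, add_zero]
        funext j
        simp [Finset.sum_apply, Pi.single_apply]
      · simp [Prod.snd_sum]
    conv_lhs => rw [h1]
    simp only [map_add, map_sum, map_smul, smul_eq_mul, cost, tilt_apply, x, mul_sub, Finset.mul_sum]
    rw [add_comm, sub_eq_add_neg, mul_comm, ← Finset.sum_neg_distrib]
    congr 1
    refine Finset.sum_congr rfl fun i _ => ?_
    field_simp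
    ring
  obtain ⟨w, hw, hnest, hlex⟩ := exists_sorted_word hsum x
  refine ⟨w, ⟨hw, hnest⟩, ?_⟩
  rw [pathPolytope_eq hn hsum]
  rintro _ ⟨γ, hγ, rfl⟩
  rw [hlx, hlx (average n γ)]
  exact mul_le_mul_of_nonneg_left (cost_average_le hn hw (monotone_of_strictMono_lex hlex) hγ) hl.le

/-- The downward ray from a lower vertex y meets the hull of the word averages. The meeting point is
y since y is a lower point, and y, being extreme, is one of the averages. -/
lemma lowerVertices_subset {lam : Fin d → ℕ} (hn : 0 < n) (hsum : ∑ i, lam i = n) :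
    lowerVertices lam ⊆ (fun w : Fin n → Fin d => average n (pathSection w)) ''
      {w : Fin n → Fin d | IsLambdaPerm lam w ∧ ¬ IsNesting w} := by
  rintro y ⟨hext, hlow⟩
  set N := {w : Fin n → Fin d | IsLambdaPerm lam w ∧ ¬ IsNesting w} with hN
  set A := (fun w : Fin n → Fin d => average n (pathSection w)) '' N with hA
  have hAP : convexHull ℝ A ⊆ pathPolytope lam := by
    refine convexHull_min ?_ (convex_pathPolytope hn hsum)
    rintro _ ⟨w, hw, rfl⟩
    exact (average_mem_lowerVertices hn hsum hw.1 hw.2).2.1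
  have hcomp : IsCompact (convexHull ℝ A) := (Set.toFinite A).isCompact_convexHull ℝ
  let D : Set ((Fin d → ℝ) × ℝ) := {y.1} ×ˢ Set.Iic y.2
  have hD : ∀ t : ℝ, 0 ≤ t → (y.1, y.2 - t) ∈ D := fun t ht => ⟨rfl, by simpa using ht⟩
  have hmeet : ¬ Disjoint (convexHull ℝ A) D := by
    intro hdisj
    obtain ⟨f, u, v, hf1, huv, hf2⟩ := geometric_hahn_banach_compact_closed
      (convex_convexHull ℝ A) hcomp ((convex_singleton y.1).prod (convex_Iic y.2))
      (isClosed_singleton.prod isClosed_Iic) hdisj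
    have hsplit : ∀ t : ℝ, f (y.1, y.2 - t) = f y - t * f (0, 1) := by
      intro t
      have : ((y.1, y.2 - t) : (Fin d → ℝ) × ℝ) = y - t • ((0 : Fin d → ℝ), (1 : ℝ)) :=
        Prod.ext (by simp) (by simp)
      rw [this, map_sub, map_smul, smul_eq_mul]
    have hfy : v < f y := by
      have := hf2 _ (hD 0 le_rfl)
      rw [hsplit] at this
      linarith
    -- The functional f stays above v on an infinite downward ray, so it cannot increase with
    -- height.
    have hf0 : f (0, 1) ≤ 0 := by
      by_contra hpos
      push Not at hpos
      have := hf2 _ (hD ((f y - v) / f (0, 1)) (by apply div_nonneg <;> linarith))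
      rw [hsplit, div_mul_cancel₀ _ hpos.ne'] at this
      linarith
    -- Only f(0,1) ≤ 0 is known, while `exists_average_le` needs a strictly vertical functional.
    -- Adding a small ε times the height to -f keeps the finitely many strict inequalities.
    have hev : ∀ᶠ ε : ℝ in nhdsWithin 0 (Set.Ioi 0), ∀ w ∈ N,
        -f y + ε * y.2 <
          -f (average n (pathSection w)) + ε * (average n (pathSection w)).2 := by
      rw [Filter.eventually_all_finite (Set.toFinite N)]
      intro w hw
      apply nhdsWithin_le_nhds
      refine ContinuousAt.eventually_lt (f := fun ε : ℝ => -f y + ε * y.2)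
        (g := fun ε : ℝ => -f (average n (pathSection w)) + ε * (average n (pathSection w)).2)
        (by fun_prop) (by fun_prop) ?_
      have := hf1 _ (subset_convexHull ℝ A ⟨w, hw, rfl⟩)
      simp only [zero_mul, add_zero]
      linarith
    obtain ⟨ε, hε, hε0⟩ := (hev.and self_mem_nhdsWithin).exists
    obtain ⟨w, hw, hle⟩ := exists_average_le hn hsum
      (-(f : ((Fin d → ℝ) × ℝ) →ₗ[ℝ] ℝ) + ε • LinearMap.snd ℝ (Fin d → ℝ) ℝ) (by
        simp only [LinearMap.add_apply, LinearMap.neg_apply, LinearMap.smul_apply,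
          LinearMap.snd_apply, smul_eq_mul, mul_one, ContinuousLinearMap.coe_coe]
        have : (0 : ℝ) < ε := hε0
        linarith)
    have h1 := hle y hext.1
    have h2 := hε w hw
    simp only [LinearMap.add_apply, LinearMap.neg_apply, LinearMap.smul_apply,
      LinearMap.snd_apply, smul_eq_mul, ContinuousLinearMap.coe_coe] at h1
    linarith
  obtain ⟨q, hqA, hqD⟩ := Set.not_disjoint_iff.1 hmeet
  have hqy : q = y := by
    obtain ⟨h1, h2⟩ := hqD
    simp only [Set.mem_singleton_iff, Set.mem_Iic] at h1 h2
    rcases h2.lt_or_eq with h2 | h2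
    · exfalso
      refine hlow.2 (y.2 - q.2) (by linarith) ?_
      rw [sub_sub_cancel, ← h1]
      exact hAP hqA
    · exact Prod.ext h1 h2
  rw [hqy] at hqA
  exact extremePoints_convexHull_subset
    (inter_extremePoints_subset_extremePoints_of_subset hAP ⟨hqA, hext⟩)

theorem ncard_lowerVertices {lam : Fin d → ℕ} (hn : 0 < n) (hsum : ∑ i, lam i = n) :
    (lowerVertices lam).ncard =
      {w : Fin n → Fin d | IsLambdaPerm lam w ∧ ¬ IsNesting w}.ncard := by
  have : lowerVertices lam = (fun w : Fin n → Fin d => average n (pathSection w)) ''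
      {w : Fin n → Fin d | IsLambdaPerm lam w ∧ ¬ IsNesting w} := by
    refine Set.Subset.antisymm (lowerVertices_subset hn hsum) ?_
    rintro _ ⟨w, hw, rfl⟩
    exact average_mem_lowerVertices hn hsum hw.1 hw.2
  rw [this]
  exact (average_injOn hn).ncard_image

end PathPolytope

end LambdaPile

end

open LambdaPile
theorem theorem2p3 (d n : ℕ) (lam : Fin d → ℕ) (hlam : ∀ i, 0 < lam i) (hn : 0 < n)
    (hsum : ∑ i, lam i = n) :
    -- coherence of the lifted path of a word
    (∀ w : Fin n → Fin d, IsLambdaPerm lam w →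
      (IsCoherent (liftedPile lam) coordSum (liftedPath w) ↔ ¬ IsNesting w)) ∧
    -- non-nesting words and regions
    Set.BijOn wordRegion {w : Fin n → Fin d | IsLambdaPerm lam w ∧ ¬ IsNesting w}
      (regions (arrangement lam)) ∧
    -- the number of coherent lifted paths, of lower vertices, and of regions
    (({p ∈ liftedMonotonePaths lam |
        IsCoherent (liftedPile lam) coordSum p.2}.ncard : ℚ) =
      (n.factorial : ℚ) / ((n - d + 1).factorial : ℚ)) ∧
    (((lowerVertices lam).ncard : ℚ) = (n.factorial : ℚ) / ((n - d + 1).factorial : ℚ)) ∧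
    (((regions (arrangement lam)).ncard : ℚ) =
      (n.factorial : ℚ) / ((n - d + 1).factorial : ℚ)) := by
  have hbij := bijOn_wordRegion hlam hsum
  have hcount := ncard_nonnesting_eq hlam hn hsum
  refine ⟨fun w hw => ⟨not_isNesting_of_isCoherent hw, isCoherent_of_not_isNesting hn hsum hw⟩,
    hbij, ?_, ?_, ?_⟩
  · rw [ncard_coherent_paths hn hsum, hcount]
  · rw [ncard_lowerVertices hn hsum, hcount]
  · rw [← hbij.image_eq, hbij.injOn.ncard_image, hcount]
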